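/- Let $\ell\neq 2$ be a prime number, let $K$ be a number field, and let $K_\infty/K$ be a $\mathbb{Z}_\ell$-extension with Galois group $\Gamma$ which is not the cyclotomic $\mathbb{Z}_\ell$-extension of $K$; let $K_n$ be its $n$-th layer (the subfield fixed by $\Gamma^{\ell^n}$). For a number field $F$ and a finite place $\mathfrak p$ of $F$ above the prime $p$, set $\deg\mathfrak p=\tilde f_{\mathfrak p}\deg p$, where $\deg p=\mathrm{Log}_\ell(p)$ for $p\ne\ell$ and $\deg \ell=\mathrm{Log}_\ell(1+\ell)$ ($\mathrm{Log}_\ell$ is Iwasawa's logarithm), where $\tilde f_{\mathfrak p}=[F_{\mathfrak p}\cap\widehat{\mathbb{Q}_\ell^{c}}:\mathbb{Q}_\ell]$ if $\mathfrak p\mid\ell$ ($\widehat{\mathbb{Q}_\ell^{c}}$ is the cyclotomic $\widehat{\mathbb{Z}}$-extension of $\mathbb{Q}_\ell$) and $\tilde f_{\mathfrak p}$ is the residue degree if $\mathfrak p\nmid\ell$. Let $\tilde v_{\mathfrak p}(x)=v_{\mathfrak p}(x)$ if $\mathfrak p\nmid\ell$ and $\tilde v_{\mathfrak p}(x)=-\mathrm{Log}_\ell(N_{F_{\mathfrak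 p}/\mathbb{Q}_\ell}(x))/\deg\mathfrak p$ if $\mathfrak p\mid\ell$. Let $\mathcal{D}\ell_F=\bigoplus_{\mathfrak p}\mathbb{Z}_\ell\,\mathfrak p$, with the degree map extended $\mathbb{Z}_\ell$-linearly, let $\mathcal{P}\ell_F$ be the image of $\mathbb{Z}_\ell\otimes_{\mathbb Z} F^\times$ under $x\mapsto\sum_{\mathfrak p}\tilde v_{\mathfrak p}(x)\mathfrak p$, let $\widetilde{C\ell}_F^{*}=\mathcal{D}\ell_F/\mathcal{P}\ell_F$ be the group of logarithmic classes of arbitrary degree, and let $\widetilde{C\ell}_F\subseteq\widetilde{C\ell}_F^{*}$ be the logarithmic class group, i.e. the subgroup of classes of degree $0$. For a finite extension $L/F$ the norm $\widetilde{C\ell}_L^{*}\to\widetilde{C\ell}_F^{*}$ is induced by $\mathfrak P\mapsto\tilde f_{\mathfrak P|\mathfrak p}\,\mathfrak p$, where $\mathfrak p=\mathfrak P\cap F$ and $\tilde f_{\mathfrak P|\mathfrak p}$ is $[L_{\mathfrak P}\cap\widehat{\mathbb{Q}_\ell^{c}}F_{\mathfrak p}:F_{\mathfrak p}]$ if $\mathfrak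 p\mid\ell$ and the residue degree if $\mathfrak p\nmid\ell$. Assume the Gross–Kuz'min conjecture for $\ell$ and every $K_n$, i.e. that $\widetilde{C\ell}_{K_n}$ is finite for every $n\ge 0$. Let $\widetilde{\mathcal C}^{*}=\varprojlim\widetilde{C\ell}_{K_n}^{*}$ and $\widetilde{\mathcal C}=\varprojlim\widetilde{C\ell}_{K_n}$ be the inverse limits under the norm maps. Then there is an isomorphism of $\mathbb{Z}_\ell$-modules $$\widetilde{\mathcal C}^{*}\simeq\widetilde{\mathcal C}\oplus\mathbb{Z}_\ell .$$ -/

import Mathlib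

set_option linter.unusedSectionVars false

open NumberField IsDedekindDomain IntermediateField

noncomputable section

namespace LogClass

/-! ### Cyclotomic extensions -/

/-- The cyclotomic `ℤ_q`-extension of `k` inside `Ω`: the subfield of `k(μ_{q^∞})` fixed by every
element of finite order of `Gal(k(μ_{q^∞})/k)`. -/
def cyclotomicZq (q : ℕ) (k Ω : Type*) [Field k] [Field Ω] [Algebra k Ω] :
    IntermediateField k Ω :=
  IntermediateField.lift
    (IntermediateField.fixedField
      (Subgroup.closure
        {σ : Gal(adjoin k {ζ : Ω | ∃ n : ℕ, ζ ^ q ^ n = 1}/k) | IsOfFinOrder σ}))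

/-- The cyclotomic `ℤ̂`-extension of `k` inside `Ω`: the compositum of the cyclotomic
`ℤ_q`-extensions, for all primes `q`. -/
def cyclotomicZhat (k Ω : Type*) [Field k] [Field Ω] [Algebra k Ω] : IntermediateField k Ω :=
  ⨆ q : Nat.Primes, cyclotomicZq q k Ω

/-! ### `ℤ_ℓ`-extensions and their layers -/

section ZpExtension

variable (ℓ : ℕ) [Fact ℓ.Prime] (K Kinf : Type*) [Field K] [Field Kinf] [Algebra K Kinf]

/-- `Kinf / K` is a `ℤ_ℓ`-extension: it is Galois, with Galois group (with its Krull topology)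
topologically isomorphic to `ℤ_ℓ`. -/
class IsZlExtension : Prop where
  isGalois : IsGalois K Kinf
  nonempty_equiv : Nonempty (Gal(Kinf/K) ≃ₜ* Multiplicative ℤ_[ℓ])

/-- `Kinf / K` is (isomorphic to) the cyclotomic `ℤ_ℓ`-extension of `K`. -/
def IsCyclotomicZlExtension : Prop :=
  Nonempty (Kinf ≃ₐ[K] cyclotomicZq ℓ K (AlgebraicClosure K))

/-- The `n`-th layer `K_n`: the subfield of `Kinf` fixed by `Γ ^ (ℓ ^ n)`, `Γ = Gal(Kinf/K)`. -/
def layer (n : ℕ) : IntermediateField K Kinf :=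
  IntermediateField.fixedField (Subgroup.closure (Set.range fun σ : Gal(Kinf/K) ↦ σ ^ ℓ ^ n))

theorem layer_le_succ (n : ℕ) : layer ℓ K Kinf n ≤ layer ℓ K Kinf (n + 1) := by
  apply IntermediateField.fixedField_antitone
  rw [Subgroup.closure_le]
  rintro _ ⟨σ, rfl⟩
  simp only [pow_succ, pow_mul]
  exact pow_mem (Subgroup.subset_closure (Set.mem_range_self σ)) ℓ

/-- `K_{n+1}` as an extension of `K_n`. -/
abbrev layerAlgebra (n : ℕ) : Algebra (layer ℓ K Kinf n) (layer ℓ K Kinf (n + 1)) :=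
  (IntermediateField.inclusion (layer_le_succ ℓ K Kinf n)).toRingHom.toAlgebra

theorem finiteDimensional_layer [IsZlExtension ℓ K Kinf] (n : ℕ) :
    FiniteDimensional K (layer ℓ K Kinf n) := by
  have := IsZlExtension.isGalois ℓ (K := K) (Kinf := Kinf)
  obtain ⟨e⟩ := IsZlExtension.nonempty_equiv (ℓ := ℓ) (K := K) (Kinf := Kinf)
  rw [← InfiniteGalois.isOpen_iff_finite]
  refine Subgroup.isOpen_mono
    (H₁ := Subgroup.closure (Set.range fun σ : Gal(Kinf/K) ↦ σ ^ ℓ ^ n))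
    ((IntermediateField.le_iff_le _ _).1 le_rfl) ?_
  refine Subgroup.isOpen_of_mem_nhds _ (g := 1) ?_
  have hU : {x : ℤ_[ℓ] | ‖x‖ < (ℓ : ℝ) ^ (-(n : ℤ) + 1)} ∈ nhds (0 : ℤ_[ℓ]) := by
    have hpos : (0 : ℝ) < (ℓ : ℝ) ^ (-(n : ℤ) + 1) :=
      zpow_pos (by exact_mod_cast (Fact.out : ℓ.Prime).pos) _
    simpa [Metric.ball, dist_eq_norm] using Metric.ball_mem_nhds (0 : ℤ_[ℓ]) hpos
  have hV : (fun σ : Gal(Kinf/K) ↦ (e σ).toAdd) ⁻¹'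
      {x : ℤ_[ℓ] | ‖x‖ < (ℓ : ℝ) ^ (-(n : ℤ) + 1)} ∈ nhds (1 : Gal(Kinf/K)) := by
    have hc : Continuous fun σ : Gal(Kinf/K) ↦ (e σ).toAdd :=
      continuous_toAdd.comp e.continuous_toFun
    exact hc.continuousAt.preimage_mem_nhds (by simpa using hU)
  filter_upwards [hV] with σ hσ
  have h1 : ‖(e σ).toAdd‖ ≤ (ℓ : ℝ) ^ (-(n : ℤ)) :=
    (PadicInt.norm_le_pow_iff_norm_lt_pow_add_one _ _).2 hσ
  rw [PadicInt.norm_le_pow_iff_mem_span_pow, Ideal.mem_span_singleton] at h1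
  obtain ⟨y, hy⟩ := h1
  refine Subgroup.subset_closure ⟨e.symm (Multiplicative.ofAdd y), ?_⟩
  apply e.injective
  simp only [map_pow]
  have h2 : e (e.symm (Multiplicative.ofAdd y)) = Multiplicative.ofAdd y := e.apply_symm_apply _
  rw [h2, ← ofAdd_nsmul, nsmul_eq_mul, Nat.cast_pow, ← hy, ofAdd_toAdd]

instance numberField_layer [NumberField K] [IsZlExtension ℓ K Kinf] (n : ℕ) :
    NumberField (layer ℓ K Kinf n) := by
  have := finiteDimensional_layer ℓ K Kinf n
  have : CharZero (layer ℓ K Kinf n) := charZero_of_injective_algebraMap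
    (algebraMap K (layer ℓ K Kinf n)).injective
  exact { to_charZero := this, to_finiteDimensional := Module.Finite.trans K _ }

end ZpExtension

/-! ### Completions -/

section Completion

variable {A : Type*} (K L : Type*) {B : Type*}
variable [CommRing A] [IsDedekindDomain A] [CommRing B] [IsDedekindDomain B] [Algebra A B]
  [Module.IsTorsionFree A B] [Field K] [Field L] [Algebra K L]
  [Algebra A K] [IsFractionRing A K] [Algebra A L] [IsScalarTower A K L]
  [Algebra B L] [IsFractionRing B L] [IsScalarTower A B L]
  (v : HeightOneSpectrum A) (w : HeightOneSpectrum B)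

/-- If `w` lies over `v`, the continuous extension `K_v → L_w` of the inclusion `K → L`. -/
def completionMap [w.asIdeal.LiesOver v.asIdeal] : v.adicCompletion K →+* w.adicCompletion L :=
  ((HeightOneSpectrum.adicCompletion.equiv L w).symm.toRingHom.comp
    (UniformSpace.Completion.mapRingHom
      (algebraMap (WithVal (v.valuation K)) (WithVal (w.valuation L)))
      (HeightOneSpectrum.uniformContinuous_algebraMap_liesOver K L v w).continuous)).comp
    (HeightOneSpectrum.adicCompletion.equiv K v).toRingHom

end Completion

section Padic

variable (ℓ : ℕ) [Fact ℓ.Prime]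

/-- The prime `ℓ` as a finite place of `ℚ`. -/
abbrev ratPlace : HeightOneSpectrum ℤ :=
  Rat.HeightOneSpectrum.primesEquiv.symm ⟨ℓ, Fact.out⟩

theorem natCast_mem_ratPlace : (ℓ : ℤ) ∈ (ratPlace ℓ).asIdeal := by
  have h := Rat.HeightOneSpectrum.natGenerator_dvd_iff (ratPlace ℓ) (n := ℓ)
  have h2 : Rat.HeightOneSpectrum.natGenerator (ratPlace ℓ) = ℓ :=
    congrArg Subtype.val (Rat.HeightOneSpectrum.primesEquiv.apply_symm_apply
      (⟨ℓ, Fact.out⟩ : Nat.Primes))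
  rw [h2] at h
  have h3 := h.1 dvd_rfl
  rw [← map_natCast (Rat.IsIntegralClosure.intEquiv ℤ) ℓ] at h3
  simpa using (Ideal.apply_mem_of_equiv_iff (f := Rat.IsIntegralClosure.intEquiv ℤ)).1 h3

variable {F : Type*} [Field F] [NumberField F] (𝔭 : HeightOneSpectrum (𝓞 F))

theorem liesOver_ratPlace (h : (ℓ : 𝓞 F) ∈ 𝔭.asIdeal) :
    𝔭.asIdeal.LiesOver (ratPlace ℓ).asIdeal := by
  have hmax : (ratPlace ℓ).asIdeal.IsMaximal := (ratPlace ℓ).isMaximal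
  refine ⟨hmax.eq_of_le (Ideal.IsPrime.under ℤ 𝔭.asIdeal).ne_top ?_⟩
  have hs : (ratPlace ℓ).asIdeal = Ideal.span {(ℓ : ℤ)} := by
    have hp : (Ideal.span {(ℓ : ℤ)}).IsMaximal :=
      PrincipalIdealRing.isMaximal_of_irreducible
        (Nat.prime_iff_prime_int.1 Fact.out).irreducible
    exact (hp.eq_of_le hmax.ne_top
      ((Ideal.span_singleton_le_iff_mem _).2 (natCast_mem_ratPlace ℓ))).symm
  rw [hs, Ideal.span_singleton_le_iff_mem, Ideal.mem_comap]
  simpa using h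

/-- For a place `𝔭 ∣ ℓ` of `F`, the canonical (continuous) embedding `ℚ_ℓ → F_𝔭`. -/
def padicMap (h : (ℓ : 𝓞 F) ∈ 𝔭.asIdeal) : ℚ_[ℓ] →+* 𝔭.adicCompletion F :=
  have := liesOver_ratPlace ℓ 𝔭 h
  (completionMap ℚ F (ratPlace ℓ) 𝔭).comp
    (Padic.adicCompletionEquiv ℤ ⟨ℓ, Fact.out⟩).toRingEquiv.toRingHom

end Padic

/-! ### Logarithmic valuations, degrees and inertia degrees -/

section LogValuation

variable (ℓ : ℕ) [Fact ℓ.Prime]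

/-- Iwasawa's logarithm `Log_ℓ` on `ℚ_ℓ^×`: the homomorphism that extends
`log (1 + z) = ∑_{k ≥ 1} (-1)^(k-1) z^k / k` (for `|z| < 1`) and vanishes at `ℓ`. For
`x = ℓ^v u` with `u` a unit, `u^(ℓ-1)` is a principal unit and
`Log_ℓ x = log (u^(ℓ-1)) / (ℓ-1)`. -/
def iwasawaLog (x : ℚ_[ℓ]) : ℚ_[ℓ] :=
  let u : ℚ_[ℓ] := x * (ℓ : ℚ_[ℓ]) ^ (-x.valuation)
  (∑' k : ℕ, (-1) ^ k * (u ^ (ℓ - 1) - 1) ^ (k + 1) / (k + 1)) / (ℓ - 1)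

/-- For an extension `L / E` of finite extensions of `ℚ_ℓ`, the logarithmic inertia degree
`[L ∩ ℚ̂_ℓ^c E : E]`, where `ℚ̂_ℓ^c` is the cyclotomic `ℤ̂`-extension of `ℚ_ℓ` (the compositum and
the intersection are taken in an algebraic closure of `L`). -/
def localLogInertiaDeg (E L : Type*) [Field E] [Field L] [Algebra ℚ_[ℓ] L] [Algebra E L] : ℕ :=
  Module.finrank E
    ↥((IsScalarTower.toAlgHom E L (AlgebraicClosure L)).fieldRange ⊓
      adjoin E (cyclotomicZhat ℚ_[ℓ] (AlgebraicClosure L) : Set (AlgebraicClosure L)))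

variable {F : Type*} [Field F] [NumberField F] (𝔭 : HeightOneSpectrum (𝓞 F))

open scoped Classical in
/-- The absolute inertia degree used for logarithmic divisors: the logarithmic inertia degree
`[F_𝔭 ∩ ℚ̂_ℓ^c : ℚ_ℓ]` if `𝔭 ∣ ℓ`, the residue degree if `𝔭 ∤ ℓ`. -/
def logInertiaDeg : ℕ :=
  if h : (ℓ : 𝓞 F) ∈ 𝔭.asIdeal then
    letI := (padicMap ℓ 𝔭 h).toAlgebra
    localLogInertiaDeg ℓ ℚ_[ℓ] (𝔭.adicCompletion F)
  else 𝔭.asIdeal.inertiaDeg ℤ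

/-- The degree of a rational prime `p`: `Log_ℓ p` if `p ≠ ℓ`, and `Log_ℓ (1 + ℓ)` if `p = ℓ`. -/
def primeDeg (p : ℕ) : ℚ_[ℓ] :=
  if p = ℓ then iwasawaLog ℓ (1 + ℓ) else iwasawaLog ℓ p

/-- The degree of a finite place `𝔭`: the inertia degree times the degree of the rational prime
below `𝔭`. -/
def placeDeg : ℚ_[ℓ] :=
  logInertiaDeg ℓ 𝔭 * primeDeg ℓ (Ideal.absNorm (𝔭.asIdeal.under ℤ))

open scoped Classical in
/-- The logarithmic valuation on `F_𝔭^×`: the usual normalised valuation if `𝔭 ∤ ℓ`, and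
`- Log_ℓ (N_{F_𝔭/ℚ_ℓ} x) / deg 𝔭` if `𝔭 ∣ ℓ`. -/
def logValuation (x : 𝔭.adicCompletion F) : ℚ_[ℓ] :=
  if h : (ℓ : 𝓞 F) ∈ 𝔭.asIdeal then
    letI := (padicMap ℓ 𝔭 h).toAlgebra;
    -iwasawaLog ℓ (Algebra.norm ℚ_[ℓ] x) / placeDeg ℓ 𝔭
  else ((-(Valued.v x).log : ℤ) : ℚ_[ℓ])

end LogValuation

/-! ### Logarithmic divisors and logarithmic classes -/

section LogClassGroup

variable (ℓ : ℕ) [Fact ℓ.Prime] (F : Type*) [Field F] [NumberField F]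

/-- The group of logarithmic divisors `⨁_𝔭 ℤ_ℓ 𝔭`. -/
abbrev LogDiv : Type _ := HeightOneSpectrum (𝓞 F) →₀ ℤ_[ℓ]

/-- The group of principal logarithmic divisors: the image of `ℤ_ℓ ⊗ F^×` under the logarithmic
divisor map, i.e. the `ℤ_ℓ`-span of the divisors `∑_𝔭 ṽ_𝔭(x) 𝔭` of the elements `x ∈ F^×`. -/
def principalLogDiv : Submodule ℤ_[ℓ] (LogDiv ℓ F) :=
  Submodule.span ℤ_[ℓ] {D | ∃ x : Fˣ, ∀ 𝔭 : HeightOneSpectrum (𝓞 F),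
    (D 𝔭 : ℚ_[ℓ]) = logValuation ℓ 𝔭 (algebraMap F (𝔭.adicCompletion F) x)}

/-- The degree of logarithmic divisors, `∑ a_𝔭 𝔭 ↦ ∑ a_𝔭 deg 𝔭`. -/
def logDegree : LogDiv ℓ F →ₗ[ℤ_[ℓ]] ℚ_[ℓ] :=
  Finsupp.linearCombination ℤ_[ℓ] fun 𝔭 ↦ placeDeg ℓ 𝔭

/-- The group `C̃ℓ_F^*` of logarithmic classes of arbitrary degree. -/
abbrev LogClassStar : Type _ := LogDiv ℓ F ⧸ principalLogDiv ℓ F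

/-- The logarithmic class group `C̃ℓ_F ⊆ C̃ℓ_F^*`: the classes of divisors of degree `0`. -/
def logClassGroup : Submodule ℤ_[ℓ] (LogClassStar ℓ F) :=
  (LinearMap.ker (logDegree ℓ F)).map (principalLogDiv ℓ F).mkQ

/-- The Gross–Kuz'min conjecture for `F` and `ℓ`: the logarithmic class group is finite. -/
def GrossKuzmin : Prop := Finite (logClassGroup ℓ F)

end LogClassGroup

/-! ### Norms -/

section Norm

variable (ℓ : ℕ) [Fact ℓ.Prime] (K : Type*) {L : Type*} [Field K] [NumberField K] [Field L]
  [NumberField L] [Algebra K L]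

open scoped Classical in
/-- The relative inertia degree of `𝔓` over `𝔭 = 𝔓 ∩ K`: the logarithmic inertia degree
`[L_𝔓 ∩ ℚ̂_ℓ^c K_𝔭 : K_𝔭]` if `𝔓 ∣ ℓ`, the residue degree if `𝔓 ∤ ℓ`. -/
def relLogInertiaDeg (𝔓 : HeightOneSpectrum (𝓞 L)) : ℕ :=
  if h : (ℓ : 𝓞 L) ∈ 𝔓.asIdeal then
    letI := (padicMap ℓ 𝔓 h).toAlgebra
    haveI : 𝔓.asIdeal.LiesOver (𝔓.under (𝓞 K)).asIdeal := ⟨rfl⟩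
    letI := (completionMap K L (𝔓.under (𝓞 K)) 𝔓).toAlgebra
    localLogInertiaDeg ℓ ((𝔓.under (𝓞 K)).adicCompletion K) (𝔓.adicCompletion L)
  else 𝔓.asIdeal.inertiaDeg (𝓞 K)

variable (L)

/-- The arithmetic norm on logarithmic divisors, `𝔓 ↦ f_{𝔓|𝔭} 𝔭`, where `𝔭 = 𝔓 ∩ K`. -/
def logNorm : LogDiv ℓ L →ₗ[ℤ_[ℓ]] LogDiv ℓ K :=
  Finsupp.linearCombination ℤ_[ℓ] fun 𝔓 ↦
    Finsupp.single (𝔓.under (𝓞 K)) (relLogInertiaDeg ℓ K 𝔓 : ℤ_[ℓ])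

/-- The graph of the norm map `C̃ℓ_L^* → C̃ℓ_K^*` induced by the norm of divisors: the pairs
formed by the class of a divisor `D` and the class of the norm of `D`. -/
def logNormGraph : Submodule ℤ_[ℓ] (LogClassStar ℓ L × LogClassStar ℓ K) :=
  LinearMap.range
    ((principalLogDiv ℓ L).mkQ.prod ((principalLogDiv ℓ K).mkQ ∘ₗ logNorm ℓ K L))

end Norm

/-! ### Inverse limits along a `ℤ_ℓ`-extension -/

section InverseLimit

variable (ℓ : ℕ) [Fact ℓ.Prime] (K Kinf : Type*) [Field K] [NumberField K] [Field Kinf]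
  [Algebra K Kinf] [IsZlExtension ℓ K Kinf]

/-- `(c_n)_n` is norm coherent: `c_n` is the norm of `c_{n+1}`, for every `n`. -/
def IsNormCoherent (c : ∀ n, LogClassStar ℓ (layer ℓ K Kinf n)) : Prop :=
  ∀ n, letI := layerAlgebra ℓ K Kinf n
    (c (n + 1), c n) ∈ logNormGraph ℓ (layer ℓ K Kinf n) (layer ℓ K Kinf (n + 1))

/-- The inverse limit `C̃^* = lim C̃ℓ_{K_n}^*` under the norm maps. -/
def limLogClassStar : Submodule ℤ_[ℓ] (∀ n, LogClassStar ℓ (layer ℓ K Kinf n)) where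
  carrier := {c | IsNormCoherent ℓ K Kinf c}
  zero_mem' _ := Submodule.zero_mem _
  add_mem' hc hd n := Submodule.add_mem _ (hc n) (hd n)
  smul_mem' a _ hc n := Submodule.smul_mem _ a (hc n)

/-- The inverse limit `C̃ = lim C̃ℓ_{K_n}` of the logarithmic class groups under the norm maps. -/
def limLogClassGroup : Submodule ℤ_[ℓ] (∀ n, logClassGroup ℓ (layer ℓ K Kinf n)) where
  carrier := {c | IsNormCoherent ℓ K Kinf fun n ↦ c n}
  zero_mem' _ := Submodule.zero_mem _
  add_mem' hc hd n := Submodule.add_mem _ (hc n) (hd n)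
  smul_mem' a _ hc n := Submodule.smul_mem _ a (hc n)

end InverseLimit

end LogClass

end

/-! The splitting comes from the degree map. Three facts make the degree a homomorphism from the
limit $\widetilde{\mathcal C}^*$ to $\mathbb{Z}_\ell$ with kernel $\widetilde{\mathcal C}$.
Principal divisors have degree $0$ by a product formula (`logDegree_eq_zero_of_mem`). The norm
preserves degrees, because logarithmic inertia degrees multiply in towers (`logDegree_logNorm`).
Degrees of places are $\ell$-adic integers (`norm_placeDeg_le_one`). Once the degree map is nonzero,
its image is a nonzero ideal of $\mathbb{Z}_\ell$, hence free of rank one, and the sequence splits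
(`nonempty_equiv_ker_prod`).

The degree map is nonzero because $K_\infty$ is not cyclotomic. For $\mathfrak p\nmid\ell$ the
degree is $\mathrm{Log}_\ell N\mathfrak p$, so a degree divisible by $\ell^N$ means $N\mathfrak
p^{\ell-1}\equiv 1$ modulo $\ell^N$. If this holds for all such places of some layer, almost all
places of that layer with $\zeta_\ell$ adjoined split completely in the field of $\ell^N$-th roots
of unity. A comparison of poles of Dedekind zeta functions then shows that these roots already lie
in the layer with $\zeta_\ell$ adjoined (`exists_isPrimitiveRoot`). If this happened for every $N$,
then $K_\infty(\zeta_\ell)$ would contain $\mu_{\ell^\infty}$, which forces $K_\infty$ to be the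
cyclotomic extension (`cyclotomicZq_eq_fieldRange`). So some fixed $\ell^N$ is the degree of a class
at every layer (`exists_lt_norm_placeDeg`).

Under Gross–Kuz'min the classes of degree $\ell^N$ at each layer form a finite set, so by
compactness they contain a norm coherent sequence (`exists_limDegree_eq`), whose degree is
$\ell^N\neq 0$. -/

namespace LogClass

/-! ### Iwasawa's logarithm on $\mathbb{Q}_\ell^\times$ -/

section PadicLog

open Filter Topology

variable {ℓ : ℕ} [Fact ℓ.Prime]

/-- Pascal's rule and $(k+1)\binom{\ell^n}{k+1}=\ell^n\binom{\ell^n-1}{k}$ show that two consecutive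
coefficients have a sum tending to $0$. -/
theorem tendsto_choose_pow_prime_sub_one (k : ℕ) :
    Tendsto (fun n : ℕ ↦ (((ℓ ^ n - 1).choose k : ℕ) : ℚ_[ℓ])) atTop (𝓝 ((-1) ^ k)) := by
  have hp : ∀ n, 0 < ℓ ^ n := fun n ↦ pow_pos (Fact.out : ℓ.Prime).pos n
  induction k with
  | zero => simp
  | succ k ih =>
    have h0 : Tendsto (fun n : ℕ ↦ (ℓ : ℚ_[ℓ]) ^ n) atTop (𝓝 0) :=
      tendsto_pow_atTop_nhds_zero_of_norm_lt_one Padic.norm_p_lt_one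
    have h1 := (((h0.mul ih).div_const ((k : ℚ_[ℓ]) + 1)).sub ih)
    rw [zero_mul, zero_div, zero_sub] at h1
    rw [pow_succ, mul_neg_one]
    refine h1.congr fun n ↦ ?_
    have h2 := Nat.add_one_mul_choose_eq (ℓ ^ n - 1) k
    rw [Nat.sub_add_cancel (hp n)] at h2
    have h3 := Nat.choose_succ_succ' (ℓ ^ n - 1) k
    rw [Nat.sub_add_cancel (hp n)] at h3
    have hk : ((k : ℚ_[ℓ]) + 1) ≠ 0 := by exact_mod_cast k.succ_ne_zero
    rw [h3] at h2
    have h4 : (ℓ : ℚ_[ℓ]) ^ n * ((ℓ ^ n - 1).choose k : ℕ) =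
      (((ℓ ^ n - 1).choose k : ℕ) + ((ℓ ^ n - 1).choose (k + 1) : ℕ)) * (k + 1) := by
      exact_mod_cast h2
    rw [h4, mul_div_cancel_right₀ _ hk]
    ring

theorem norm_inv_natCast_succ_le (k : ℕ) : ‖((k : ℚ_[ℓ]) + 1)⁻¹‖ ≤ k + 1 := by
  have h : ‖((k + 1 : ℕ) : ℚ_[ℓ])‖⁻¹ ≤ ((k + 1 : ℕ) : ℝ) := by
    rw [Padic.norm_eq_zpow_neg_valuation (by exact_mod_cast k.succ_ne_zero), ← zpow_neg, neg_neg,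
      Padic.valuation_natCast, zpow_natCast]
    exact_mod_cast Nat.le_of_dvd k.succ_pos pow_padicValNat_dvd
  rw [norm_inv]
  exact_mod_cast h

/-- The binomial expansion of the quotient has coefficients $\binom{\ell^n-1}{k}/(k+1)$, and
dominated convergence applies. Describing the logarithm as a limit gives its additivity and its
absolute value without manipulating power series. -/
theorem tendsto_pow_prime_pow_sub_one_div {z : ℚ_[ℓ]} (hz : ‖z‖ < 1) :
    Tendsto (fun n : ℕ ↦ ((1 + z) ^ ℓ ^ n - 1) / (ℓ : ℚ_[ℓ]) ^ n) atTop
      (𝓝 (∑' k : ℕ, (-1) ^ k * z ^ (k + 1) / (k + 1))) := by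
  have hp : ∀ n, 0 < ℓ ^ n := fun n ↦ pow_pos (Fact.out : ℓ.Prime).pos n
  have key : ∀ n : ℕ, ((1 + z) ^ ℓ ^ n - 1) / (ℓ : ℚ_[ℓ]) ^ n =
      ∑' k : ℕ, (((ℓ ^ n - 1).choose k : ℕ) : ℚ_[ℓ]) * z ^ (k + 1) / (k + 1) := by
    intro n
    rw [tsum_eq_sum (s := Finset.range (ℓ ^ n)), add_comm 1 z, add_pow, Finset.sum_range_succ']
    · simp only [one_pow, mul_one, pow_zero, Nat.choose_zero_right, Nat.cast_one, add_sub_cancel_right]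
      rw [Finset.sum_div]
      refine Finset.sum_congr rfl fun k _ ↦ ?_
      have hk : ((k : ℚ_[ℓ]) + 1) ≠ 0 := by exact_mod_cast k.succ_ne_zero
      have hn : (ℓ : ℚ_[ℓ]) ^ n ≠ 0 := by exact_mod_cast (hp n).ne'
      rw [div_eq_div_iff hn hk]
      have h2 := Nat.add_one_mul_choose_eq (ℓ ^ n - 1) k
      rw [Nat.sub_add_cancel (hp n)] at h2
      have h4 : (ℓ : ℚ_[ℓ]) ^ n * ((ℓ ^ n - 1).choose k : ℕ) =
        ((ℓ ^ n).choose (k + 1) : ℕ) * (k + 1) := by exact_mod_cast h2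
      linear_combination -z ^ (k + 1) * h4
    · intro k hk
      rw [Nat.choose_eq_zero_of_lt]
      · simp
      · have := hp n; simp at hk; omega
  simp_rw [key]
  have hs : Summable fun k : ℕ ↦ ((k : ℝ) + 1) * ‖z‖ ^ (k + 1) := by
    have := summable_pow_mul_geometric_of_norm_lt_one 1 (r := ‖z‖) (by simpa using hz)
    simpa using (summable_nat_add_iff 1).2 this
  refine tendsto_tsum_of_dominated_convergence hs (fun k ↦ ?_) (.of_forall fun n k ↦ ?_)
  · exact ((tendsto_choose_pow_prime_sub_one k).mul_const _).div_const _
  · rw [mul_div_assoc, div_eq_mul_inv, norm_mul, norm_mul, norm_pow, mul_comm (‖z‖ ^ _)]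
    calc _ ≤ 1 * (((k : ℝ) + 1) * ‖z‖ ^ (k + 1)) := by
          gcongr
          · exact_mod_cast Padic.norm_int_le_one ((ℓ ^ n - 1).choose k : ℤ)
          · exact norm_inv_natCast_succ_le k
      _ = _ := one_mul _

/-- The series `log (1 + z) = ∑ (-1)^k z^(k+1) / (k+1)` evaluated at `u = 1 + z`. -/
noncomputable def padicLog (u : ℚ_[ℓ]) : ℚ_[ℓ] := ∑' k : ℕ, (-1) ^ k * (u - 1) ^ (k + 1) / (k + 1)

theorem tendsto_padicLog {u : ℚ_[ℓ]} (hu : ‖u - 1‖ < 1) :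
    Tendsto (fun n : ℕ ↦ (u ^ ℓ ^ n - 1) / (ℓ : ℚ_[ℓ]) ^ n) atTop (𝓝 (padicLog u)) := by
  simpa [padicLog] using tendsto_pow_prime_pow_sub_one_div hu

theorem norm_eq_one_of_norm_sub_one_lt_one {u : ℚ_[ℓ]} (hu : ‖u - 1‖ < 1) : ‖u‖ = 1 := by
  have h := IsUltrametricDist.norm_add_eq_max_of_norm_ne_norm (x := u - 1) (y := 1)
    (by simpa using hu.ne)
  simpa [hu.le] using h

theorem norm_mul_sub_one_lt_one {u v : ℚ_[ℓ]} (hu : ‖u - 1‖ < 1) (hv : ‖v - 1‖ < 1) :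
    ‖u * v - 1‖ < 1 := by
  have h : u * v - 1 = u * (v - 1) + (u - 1) := by ring
  rw [h]
  refine (IsUltrametricDist.norm_add_le_max _ _).trans_lt (max_lt ?_ hu)
  rwa [norm_mul, norm_eq_one_of_norm_sub_one_lt_one hu, one_mul]

/-- For odd $\ell$ and $u\equiv 1$ modulo $\ell$, the cofactor $1+u+\dots+u^{\ell-1}$ is congruent
to $\ell$ modulo $\ell^2$. This fails for $\ell=2$. -/
theorem norm_pow_prime_sub_one (hℓ : ℓ ≠ 2) {u : ℚ_[ℓ]} (hu : ‖u - 1‖ < 1) :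
    ‖u ^ ℓ - 1‖ = ‖u - 1‖ * ‖(ℓ : ℚ_[ℓ])‖ := by
  have hodd : Odd ℓ := (Fact.out : ℓ.Prime).odd_of_ne_two hℓ
  obtain ⟨y, hy⟩ := (PadicInt.norm_lt_one_iff_dvd (⟨u - 1, hu.le⟩ : ℤ_[ℓ])).1 hu
  have hy' : u - 1 = ℓ * y := by simpa using congrArg (Subtype.val) hy
  obtain ⟨c, hc⟩ := odd_sq_dvd_geom_sum₂_sub (a := (1 : ℤ_[ℓ])) (b := y) hodd
  have hg := (Commute.one_right (1 + (ℓ : ℤ_[ℓ]) * y)).geom_sum₂_mul ℓ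
  rw [sub_eq_iff_eq_add.1 hc] at hg
  have hg' := congrArg (Subtype.val) hg
  have hu1 : u = 1 + ℓ * y := by rw [← hy']; ring
  have h1 : u ^ ℓ - 1 = ℓ * (1 + ℓ * c) * (u - 1) := by
    rw [hu1]
    simp only [one_pow, mul_one] at hg'
    push_cast at hg'
    rw [← hg']
    ring
  have h2 : ‖(1 : ℚ_[ℓ]) + ℓ * c‖ = 1 := by
    apply norm_eq_one_of_norm_sub_one_lt_one
    rw [add_sub_cancel_left, norm_mul]
    exact (mul_le_of_le_one_right (norm_nonneg _) c.2).trans_lt Padic.norm_p_lt_one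
  rw [h1, norm_mul, norm_mul, h2, mul_one, mul_comm]

theorem norm_pow_prime_pow_sub_one (hℓ : ℓ ≠ 2) {u : ℚ_[ℓ]} (hu : ‖u - 1‖ < 1) (n : ℕ) :
    ‖u ^ ℓ ^ n - 1‖ = ‖u - 1‖ * ‖(ℓ : ℚ_[ℓ]) ^ n‖ := by
  induction n with
  | zero => simp
  | succ n ih =>
    have h : ‖u ^ ℓ ^ n - 1‖ < 1 := by
      rw [ih]
      refine (mul_le_of_le_one_right (norm_nonneg _) ?_).trans_lt hu
      rw [norm_pow]
      exact pow_le_one₀ (norm_nonneg _) Padic.norm_p_lt_one.le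
    rw [pow_succ, pow_mul, norm_pow_prime_sub_one hℓ h, ih, pow_succ, norm_mul, mul_assoc]

theorem norm_padicLog (hℓ : ℓ ≠ 2) {u : ℚ_[ℓ]} (hu : ‖u - 1‖ < 1) : ‖padicLog u‖ = ‖u - 1‖ := by
  refine tendsto_nhds_unique (tendsto_padicLog hu).norm (tendsto_const_nhds.congr fun n ↦ ?_)
  rw [norm_div, norm_pow_prime_pow_sub_one hℓ hu, mul_div_cancel_right₀]
  exact norm_ne_zero_iff.2 (pow_ne_zero _ (by exact_mod_cast (Fact.out : ℓ.Prime).ne_zero))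

/-- Pass to the limit in $u^qv^q-1=(u^q-1)(v^q-1)+(u^q-1)+(v^q-1)$ with $q=\ell^n$. After division
by $q$, the product term is $q$ times a convergent sequence. -/
theorem padicLog_mul {u v : ℚ_[ℓ]} (hu : ‖u - 1‖ < 1) (hv : ‖v - 1‖ < 1) :
    padicLog (u * v) = padicLog u + padicLog v := by
  have h0 : Tendsto (fun n : ℕ ↦ (ℓ : ℚ_[ℓ]) ^ n) atTop (𝓝 0) :=
    tendsto_pow_atTop_nhds_zero_of_norm_lt_one Padic.norm_p_lt_one
  have h1 := h0.mul ((tendsto_padicLog hu).mul (tendsto_padicLog hv))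
  have h2 := (h1.add (tendsto_padicLog hu)).add (tendsto_padicLog hv)
  rw [zero_mul, zero_add] at h2
  refine tendsto_nhds_unique (tendsto_padicLog (norm_mul_sub_one_lt_one hu hv)) (h2.congr fun n ↦ ?_)
  have hn : (ℓ : ℚ_[ℓ]) ^ n ≠ 0 := pow_ne_zero _ (by simpa using (Fact.out : ℓ.Prime).ne_zero)
  field_simp
  ring

/-- The unit part `x ℓ^(-v(x))`. -/
noncomputable def unitPart (x : ℚ_[ℓ]) : ℚ_[ℓ] := x * (ℓ : ℚ_[ℓ]) ^ (-x.valuation)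

theorem iwasawaLog_eq (x : ℚ_[ℓ]) : iwasawaLog ℓ x = padicLog (unitPart x ^ (ℓ - 1)) / (ℓ - 1) := rfl

theorem norm_unitPart {x : ℚ_[ℓ]} (hx : x ≠ 0) : ‖unitPart x‖ = 1 := by
  have : (ℓ : ℝ) ≠ 0 := by exact_mod_cast (Fact.out : ℓ.Prime).ne_zero
  rw [unitPart, norm_mul, Padic.norm_eq_zpow_neg_valuation hx, norm_zpow, Padic.norm_p, inv_zpow',
    neg_neg, ← zpow_add₀ this, neg_add_cancel, zpow_zero]

theorem unitPart_mul {x y : ℚ_[ℓ]} (hx : x ≠ 0) (hy : y ≠ 0) :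
    unitPart (x * y) = unitPart x * unitPart y := by
  have : (ℓ : ℚ_[ℓ]) ≠ 0 := by exact_mod_cast (Fact.out : ℓ.Prime).ne_zero
  rw [unitPart, unitPart, unitPart, Padic.valuation_mul hx hy, neg_add, zpow_add₀ this]
  ring

theorem unitPart_of_norm_eq_one {x : ℚ_[ℓ]} (hx : ‖x‖ = 1) : unitPart x = x := by
  have h0 : x ≠ 0 := fun h ↦ by simp [h] at hx
  have : x.valuation = 0 := by
    rw [Padic.norm_eq_zpow_neg_valuation h0] at hx
    have h1 : (1 : ℝ) < ℓ := by exact_mod_cast (Fact.out : ℓ.Prime).one_lt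
    have := (zpow_eq_one_iff_right₀ (by positivity) h1.ne').1 hx
    omega
  simp [unitPart, this]

theorem norm_pow_sub_one_lt_one {x : ℚ_[ℓ]} (hx : ‖x‖ = 1) : ‖x ^ (ℓ - 1) - 1‖ < 1 := by
  let y : ℤ_[ℓ] := ⟨x, hx.le⟩
  have hy : PadicInt.toZMod y ≠ 0 := by
    intro h
    have h1 : y ∈ RingHom.ker (PadicInt.toZMod (p := ℓ)) := h
    rw [PadicInt.ker_toZMod, PadicInt.maximalIdeal_eq_span_p, Ideal.mem_span_singleton,
      ← PadicInt.norm_lt_one_iff_dvd] at h1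
    exact h1.ne hx
  have h2 : y ^ (ℓ - 1) - 1 ∈ RingHom.ker (PadicInt.toZMod (p := ℓ)) := by
    rw [RingHom.mem_ker, map_sub, map_pow, map_one, ZMod.pow_card_sub_one_eq_one hy, sub_self]
  rw [PadicInt.ker_toZMod, PadicInt.maximalIdeal_eq_span_p, Ideal.mem_span_singleton,
    ← PadicInt.norm_lt_one_iff_dvd] at h2
  exact h2

theorem iwasawaLog_mul {x y : ℚ_[ℓ]} (hx : x ≠ 0) (hy : y ≠ 0) :
    iwasawaLog ℓ (x * y) = iwasawaLog ℓ x + iwasawaLog ℓ y := by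
  rw [iwasawaLog_eq, iwasawaLog_eq, iwasawaLog_eq, unitPart_mul hx hy, mul_pow, padicLog_mul
    (norm_pow_sub_one_lt_one (norm_unitPart hx)) (norm_pow_sub_one_lt_one (norm_unitPart hy)),
    add_div]

theorem iwasawaLog_one : iwasawaLog ℓ 1 = 0 := by
  have := iwasawaLog_mul (ℓ := ℓ) one_ne_zero one_ne_zero
  rw [mul_one] at this
  simpa using this

theorem iwasawaLog_neg_one : iwasawaLog ℓ (-1) = 0 := by
  have := iwasawaLog_mul (ℓ := ℓ) (x := -1) (y := -1) (by simp) (by simp)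
  rw [neg_mul_neg, mul_one, iwasawaLog_one] at this
  simpa using this.symm

theorem iwasawaLog_inv {x : ℚ_[ℓ]} (hx : x ≠ 0) : iwasawaLog ℓ x⁻¹ = -iwasawaLog ℓ x := by
  have := iwasawaLog_mul hx (inv_ne_zero hx)
  rw [mul_inv_cancel₀ hx, iwasawaLog_one] at this
  linear_combination -this

theorem iwasawaLog_pow {x : ℚ_[ℓ]} (hx : x ≠ 0) (n : ℕ) :
    iwasawaLog ℓ (x ^ n) = n * iwasawaLog ℓ x := by
  induction n with
  | zero => simp [iwasawaLog_one]
  | succ n ih => rw [pow_succ, iwasawaLog_mul (pow_ne_zero _ hx) hx, ih]; push_cast; ring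

theorem iwasawaLog_prod {ι : Type*} (s : Finset ι) (f : ι → ℚ_[ℓ]) (hf : ∀ i ∈ s, f i ≠ 0) :
    iwasawaLog ℓ (∏ i ∈ s, f i) = ∑ i ∈ s, iwasawaLog ℓ (f i) := by
  classical
  induction s using Finset.induction_on with
  | empty => simp [iwasawaLog_one]
  | insert a s ha ih =>
    rw [Finset.prod_insert ha, Finset.sum_insert ha, iwasawaLog_mul (hf _ (by simp))
      (Finset.prod_ne_zero_iff.2 fun i hi ↦ hf i (by simp [hi])), ih fun i hi ↦ hf i (by simp [hi])]

theorem iwasawaLog_prime : iwasawaLog ℓ (ℓ : ℚ_[ℓ]) = 0 := by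
  have : (ℓ : ℚ_[ℓ]) ≠ 0 := by exact_mod_cast (Fact.out : ℓ.Prime).ne_zero
  have h : unitPart (ℓ : ℚ_[ℓ]) = unitPart 1 := by
    rw [unitPart_of_norm_eq_one norm_one, unitPart, Padic.valuation_p, zpow_neg_one,
      mul_inv_cancel₀ this]
  rw [iwasawaLog_eq, h, ← iwasawaLog_eq, iwasawaLog_one]

theorem norm_prime_sub_one : ‖(ℓ : ℚ_[ℓ]) - 1‖ = 1 := by
  have h := IsUltrametricDist.norm_add_eq_max_of_norm_ne_norm (x := (ℓ : ℚ_[ℓ])) (y := -1)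
    (by rw [norm_neg, norm_one]; exact Padic.norm_p_lt_one.ne)
  rw [norm_neg, norm_one, max_eq_right Padic.norm_p_lt_one.le] at h
  rw [sub_eq_add_neg, h]

/-- This turns divisibility of the degree of a place prime to $\ell$ into a congruence for its norm.
-/
theorem norm_iwasawaLog (hℓ : ℓ ≠ 2) {x : ℚ_[ℓ]} (hx : ‖x‖ = 1) :
    ‖iwasawaLog ℓ x‖ = ‖x ^ (ℓ - 1) - 1‖ := by
  rw [iwasawaLog_eq, unitPart_of_norm_eq_one hx, norm_div,
    norm_padicLog hℓ (norm_pow_sub_one_lt_one hx), norm_prime_sub_one, div_one]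

theorem norm_iwasawaLog_le_one (hℓ : ℓ ≠ 2) {x : ℚ_[ℓ]} (hx : x ≠ 0) : ‖iwasawaLog ℓ x‖ ≤ 1 := by
  rw [iwasawaLog_eq, norm_div, norm_prime_sub_one, div_one,
    norm_padicLog hℓ (norm_pow_sub_one_lt_one (norm_unitPart hx))]
  exact (norm_pow_sub_one_lt_one (norm_unitPart hx)).le

theorem iwasawaLog_one_add_prime_ne_zero (hℓ : ℓ ≠ 2) : iwasawaLog ℓ (1 + ℓ : ℚ_[ℓ]) ≠ 0 := by
  have hlt : ‖(1 + ℓ : ℚ_[ℓ]) - 1‖ < 1 := by simpa using Padic.norm_p_lt_one (p := ℓ)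
  rw [← norm_ne_zero_iff, norm_iwasawaLog hℓ (norm_eq_one_of_norm_sub_one_lt_one hlt), norm_ne_zero_iff,
    sub_ne_zero]
  intro h
  have h1 : 1 < (1 + ℓ) ^ (ℓ - 1) := Nat.one_lt_pow (by have := (Fact.out : ℓ.Prime).two_le; omega)
    (by have := (Fact.out : ℓ.Prime).two_le; omega)
  have h2 : (1 + ℓ) ^ (ℓ - 1) = 1 := by exact_mod_cast h
  omega

end PadicLog

end LogClass

namespace LogClass

/-! ### Completions above $\ell$ and the global norm as a product of local norms -/

section NormPi

theorem norm_pi {R ι : Type*} [CommRing R] [Fintype ι] {A : ι → Type*}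
    [∀ i, CommRing (A i)] [∀ i, Algebra R (A i)] [∀ i, Module.Free R (A i)]
    [∀ i, Module.Finite R (A i)] (x : ∀ i, A i) :
    Algebra.norm R x = ∏ i, Algebra.norm R (x i) := by
  classical
  -- The determinant formula for block triangular matrices orders the blocks; any order will do.
  let : LinearOrder ι := IsWellOrder.linearOrder WellOrderingRel
  let b := fun i ↦ Module.Free.chooseBasis R (A i)
  have h : Algebra.leftMulMatrix (Pi.basis b) x =
      Matrix.blockDiagonal' fun i ↦ Algebra.leftMulMatrix (b i) (x i) := by
    ext ⟨i, k⟩ ⟨j, l⟩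
    rw [Algebra.leftMulMatrix_eq_repr_mul, Pi.basis_repr, Pi.basis_apply]
    by_cases hij : i = j
    · subst hij
      rw [Matrix.blockDiagonal'_apply_eq, Algebra.leftMulMatrix_eq_repr_mul]
      simp
    · rw [Matrix.blockDiagonal'_apply_ne _ _ _ hij]
      simp [hij]
  have h2 : Matrix.BlockTriangular
      (Matrix.blockDiagonal' fun i ↦ Algebra.leftMulMatrix (b i) (x i)) Sigma.fst :=
    Matrix.blockTriangular_blockDiagonal' _
  rw [Algebra.norm_eq_matrix_det (Pi.basis b), h, h2.det_fintype]
  refine Finset.prod_congr rfl fun i _ ↦ ?_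
  rw [Algebra.norm_eq_matrix_det (b i), ← Matrix.det_submatrix_equiv_self
    (Equiv.sigmaSubtype i).symm]
  congr 1
  ext k l
  exact Matrix.blockDiagonal'_apply_eq (fun i ↦ Algebra.leftMulMatrix (b i) (x i)) i k l

end NormPi

section CompletionMap

open UniformSpace

variable {A K L B : Type*}
variable [CommRing A] [IsDedekindDomain A] [CommRing B] [IsDedekindDomain B] [Algebra A B]
  [Module.IsTorsionFree A B] [Field K] [Field L] [Algebra K L]
  [Algebra A K] [IsFractionRing A K] [Algebra A L] [IsScalarTower A K L]
  [Algebra B L] [IsFractionRing B L] [IsScalarTower A B L]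
  (v : HeightOneSpectrum A) (w : HeightOneSpectrum B) [w.asIdeal.LiesOver v.asIdeal]

theorem continuous_completionMap : Continuous (completionMap K L v w) := by
  unfold completionMap
  have h1 : Continuous (HeightOneSpectrum.adicCompletion.equiv L w).symm.toRingHom :=
    HeightOneSpectrum.adicCompletion.continuous_ofCompletion L w
  have h2 : Continuous (HeightOneSpectrum.adicCompletion.equiv K v).toRingHom :=
    HeightOneSpectrum.adicCompletion.continuous_toCompletion K v
  have h3 : Continuous (Completion.mapRingHom
      (algebraMap (WithVal (v.valuation K)) (WithVal (w.valuation L)))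
      (HeightOneSpectrum.uniformContinuous_algebraMap_liesOver K L v w).continuous) :=
    Completion.continuous_map
  exact (h1.comp h3).comp h2

end CompletionMap

section PadicMap

variable {ℓ : ℕ} [Fact ℓ.Prime] {F : Type*} [Field F] [NumberField F]
  {𝔭 : HeightOneSpectrum (𝓞 F)} (h : (ℓ : 𝓞 F) ∈ 𝔭.asIdeal)

theorem continuous_padicMap : Continuous (padicMap ℓ 𝔭 h) :=
  have := liesOver_ratPlace ℓ 𝔭 h
  (continuous_completionMap (K := ℚ) (L := F) (ratPlace ℓ) 𝔭).comp
    (Padic.adicCompletionEquiv ℤ ⟨ℓ, Fact.out⟩).continuous_toFun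

theorem completionMap_padicMap {E : Type*} [Field E] [NumberField E] [Algebra F E]
    {𝔓 : HeightOneSpectrum (𝓞 E)} [𝔓.asIdeal.LiesOver 𝔭.asIdeal] (h' : (ℓ : 𝓞 E) ∈ 𝔓.asIdeal)
    (x : ℚ_[ℓ]) : completionMap F E 𝔭 𝔓 (padicMap ℓ 𝔭 h x) = padicMap ℓ 𝔓 h' x := by
  have := DenseRange.equalizer (Padic.denseRange_ratCast ℓ)
    ((continuous_completionMap (K := F) (L := E) 𝔭 𝔓).comp (continuous_padicMap h))
    (continuous_padicMap h') (by ext q; simp)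
  exact congrFun this x

theorem valued_padicMap_le_one (x : ℤ_[ℓ]) : Valued.v (padicMap ℓ 𝔭 h x) ≤ 1 := by
  have hc : IsClosed {x : ℤ_[ℓ] | padicMap ℓ 𝔭 h x ∈
      ((Valued.v (R := 𝔭.adicCompletion F)).valuationSubring : Set (𝔭.adicCompletion F))} :=
    (Valued.isClosed_valuationSubring _).preimage
      ((continuous_padicMap h).comp continuous_subtype_val)
  exact PadicInt.denseRange_intCast.induction_on x hc fun n ↦ by
    have := intCast_mem (Valued.v (R := 𝔭.adicCompletion F)).valuationSubring n
    change padicMap ℓ 𝔭 h ((n : ℤ_[ℓ]) : ℚ_[ℓ]) ∈ (Valued.v (R := 𝔭.adicCompletion F)).valuationSubring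
    rwa [PadicInt.coe_intCast, map_intCast]

theorem valued_algebraMap (x : F) (𝔭 : HeightOneSpectrum (𝓞 F)) :
    Valued.v (algebraMap F (𝔭.adicCompletion F) x) = 𝔭.valuation F x :=
  𝔭.valuedAdicCompletion_eq_valuation' x

end PadicMap

section LocalProduct

open Filter Topology

variable (ℓ : ℕ) [Fact ℓ.Prime] (F : Type*) [Field F] [NumberField F]

/-- The places of `F` above `ℓ`. -/
abbrev PlaceAbove : Type _ := {𝔭 : HeightOneSpectrum (𝓞 F) // (ℓ : 𝓞 F) ∈ 𝔭.asIdeal}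

variable {F} in
/-- `F_𝔭` as a `ℚ_ℓ`-algebra, for `𝔭 ∣ ℓ`. -/
noncomputable abbrev padicAlgebra (v : PlaceAbove ℓ F) : Algebra ℚ_[ℓ] (v.1.adicCompletion F) :=
  (padicMap ℓ v.1 v.2).toAlgebra

attribute [local instance] padicAlgebra

instance finite_placeAbove : Finite (PlaceAbove ℓ F) := by
  have h : Ideal.span {(ℓ : 𝓞 F)} ≠ 0 := by
    simpa using (Fact.out : ℓ.Prime).ne_zero
  refine ((Ideal.finite_factors h).subset fun v hv ↦ ?_).to_subtype
  exact Ideal.dvd_span_singleton.2 hv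

/-- The product of the completions of `F` at the places above `ℓ`. -/
abbrev LocalProduct : Type _ := ∀ v : PlaceAbove ℓ F, v.1.adicCompletion F

variable {F} in
/-- The diagonal embedding of `F` in the product of its completions above `ℓ`. -/
noncomputable def diagonal : F →+* LocalProduct ℓ F := RingHom.pi fun v ↦ algebraMap F (v.1.adicCompletion F)

variable {ℓ F}

theorem tendsto_algebraMap_of_mem_pow {𝔭 : HeightOneSpectrum (𝓞 F)} {a : ℕ → 𝓞 F}
    (ha : ∀ k, a k ∈ 𝔭.asIdeal ^ k) :
    Tendsto (fun k ↦ algebraMap F (𝔭.adicCompletion F) (a k)) atTop (𝓝 0) := by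
  rw [tendsto_zero_iff_norm_tendsto_zero]
  have h1 : (1 : ℝ) < Ideal.absNorm 𝔭.asIdeal := by
    exact_mod_cast HeightOneSpectrum.one_lt_absNorm 𝔭
  refine squeeze_zero (fun _ ↦ norm_nonneg _) (fun k ↦ ?_)
    (tendsto_pow_atTop_nhds_zero_of_lt_one (r := ((Ideal.absNorm 𝔭.asIdeal : ℝ))⁻¹)
      (by positivity) (inv_lt_one_of_one_lt₀ h1))
  have h2 := (𝔭.intValuation_le_pow_iff_mem (a k) k).2 (ha k)
  have h3 : ‖algebraMap F (𝔭.adicCompletion F) (a k)‖ = _ :=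
    FinitePlace.norm_embedding_int F 𝔭 (a k)
  rw [h3]
  have h4 : (1 : NNReal) < Ideal.absNorm 𝔭.asIdeal := by exact_mod_cast h1
  have h5 := (WithZeroMulInt.toNNReal_strictMono h4).monotone h2
  rw [WithZeroMulInt.toNNReal_neg_apply _ WithZero.exp_ne_zero] at h5
  refine (NNReal.coe_le_coe.2 h5).trans_eq ?_
  have h6 : WithZero.unzero (WithZero.exp_ne_zero (a := -(k : ℤ))) = .ofAdd (-(k : ℤ)) :=
    WithZero.unzero_coe _
  rw [h6]
  simp

theorem continuous_smul_padic (v : PlaceAbove ℓ F) :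
    ContinuousSMul ℚ_[ℓ] (v.1.adicCompletion F) where
  continuous_smul := by
    simp only [Algebra.smul_def]
    exact ((continuous_padicMap v.2).comp continuous_fst).mul continuous_snd

theorem ratCast_smul_diagonal (q : ℚ) (x : F) :
    (q : ℚ_[ℓ]) • diagonal ℓ x = diagonal ℓ (q • x) := by
  funext v
  change padicMap ℓ v.1 v.2 q * algebraMap F _ x = algebraMap F _ (q • x)
  rw [Algebra.smul_def, map_mul, map_ratCast, eq_ratCast, map_ratCast]

/-- Away from $\ell$ the quotient $y/\ell^k$ is integral since $\ell$ is a unit there, so only the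
places above $\ell$ need a hypothesis. -/
theorem exists_integer_of_valuation_le {y : 𝓞 F} {k : ℕ} (hy : ∀ v : PlaceAbove ℓ F,
    v.1.valuation F y ≤ v.1.valuation F ((ℓ : F) ^ k)) : ∃ z : 𝓞 F, y = (ℓ : 𝓞 F) ^ k * z := by
  have h0 : (ℓ : F) ^ k ≠ 0 := pow_ne_zero _ (by exact_mod_cast (Fact.out : ℓ.Prime).ne_zero)
  obtain ⟨z, hz⟩ := HeightOneSpectrum.mem_integers_of_valuation_le_one (R := 𝓞 F) F
    ((y : F) / (ℓ : F) ^ k) fun v ↦ by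
      rw [map_div₀]
      refine div_le_one_of_le₀ ?_ zero_le
      by_cases hv : (ℓ : 𝓞 F) ∈ v.asIdeal
      · exact hy ⟨v, hv⟩
      · have : v.valuation F (algebraMap (𝓞 F) F (ℓ : 𝓞 F)) = 1 :=
          (HeightOneSpectrum.valuation_eq_one_iff_notMem v).2 hv
        rw [map_natCast] at this
        rw [map_pow, this, one_pow]
        exact v.valuation_le_one y
  refine ⟨z, RingOfIntegers.ext ?_⟩
  have := (eq_div_iff h0).1 hz
  rw [← this]
  simp [mul_comm]

/-- Take a relation with coefficients in $\mathbb{Z}_\ell$ and truncate it modulo $\ell^k$. The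
resulting algebraic integer is divisible by $\ell^k$ at every place above $\ell$, hence in
$\mathcal{O}_F$, hence so are its coordinates. Each coefficient is therefore divisible by all powers
of $\ell$. -/
theorem linearIndependent_diagonal_integralBasis :
    LinearIndependent ℚ_[ℓ] fun i ↦ diagonal ℓ (integralBasis F i) := by
  let : Algebra ℤ_[ℓ] (LocalProduct ℓ F) :=
    ((algebraMap ℚ_[ℓ] (LocalProduct ℓ F)).comp (algebraMap ℤ_[ℓ] ℚ_[ℓ])).toAlgebra
  have : IsScalarTower ℤ_[ℓ] ℚ_[ℓ] (LocalProduct ℓ F) := .of_algebraMap_eq fun _ ↦ rfl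
  rw [← LinearIndependent.iff_fractionRing (R := ℤ_[ℓ]), Fintype.linearIndependent_iff]
  intro g hg i
  have hp : (1 : ℝ) < ℓ := by exact_mod_cast (Fact.out : ℓ.Prime).one_lt
  have key : ∀ k : ℕ, (ℓ : ℤ_[ℓ]) ^ k ∣ g i := by
    intro k
    choose c hc using fun j ↦ Ideal.mem_span_singleton.1 (PadicInt.appr_spec k (g j))
    let b := RingOfIntegers.basis F
    let y : 𝓞 F := ∑ j, ((g j).appr k : ℤ) • b j
    obtain ⟨z, hz⟩ := exists_integer_of_valuation_le (ℓ := ℓ) (y := y) (k := k) fun v ↦ by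
      -- The full relation vanishes, so the truncation equals minus the remainder, which is visibly
      -- $\ell^k$ times an integral element.
      have h1 : algebraMap F (v.1.adicCompletion F) y =
          -(algebraMap F (v.1.adicCompletion F) ((ℓ : F) ^ k) *
          ∑ j, padicMap ℓ v.1 v.2 (c j) * algebraMap F (v.1.adicCompletion F) (b j)) := by
        have h2 := congrFun hg v
        rw [Finset.sum_apply] at h2
        have hy : (y : F) = ∑ j, ((g j).appr k : F) * b j := by simp [y]
        rw [hy, eq_neg_iff_add_eq_zero, Finset.mul_sum, map_sum, ← Finset.sum_add_distrib]
        refine (Finset.sum_congr rfl fun j _ ↦ ?_).trans h2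
        have h3 : (g j : ℚ_[ℓ]) = (g j).appr k + ℓ ^ k * c j := by
          have e : g j = ℓ ^ k * c j + (g j).appr k := sub_eq_iff_eq_add.1 (hc j)
          have e' := congrArg (fun x : ℤ_[ℓ] ↦ (x : ℚ_[ℓ])) e
          simp only [PadicInt.coe_add, PadicInt.coe_mul, PadicInt.coe_pow, PadicInt.coe_natCast]
            at e'
          rw [e', add_comm]
        have h4 : (g j • diagonal ℓ (integralBasis F j)) v = padicMap ℓ v.1 v.2 (g j) *
          algebraMap F (v.1.adicCompletion F) (integralBasis F j) := rfl
        rw [h4, h3, integralBasis_apply]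
        simp
        ring
      rw [← valued_algebraMap, ← valued_algebraMap, h1, Valuation.map_neg, map_mul]
      refine mul_le_of_le_one_right' (Valuation.map_sum_le _ fun j _ ↦ ?_)
      rw [map_mul]
      refine mul_le_one' (valued_padicMap_le_one v.2 _) ?_
      rw [valued_algebraMap]
      exact v.1.valuation_le_one _
    have h5 : ((g i).appr k : ℤ) = ℓ ^ k * b.repr z i := by
      have := congrArg (fun x ↦ b.repr x i) hz
      simp only [y] at this
      rw [b.repr_sum_self] at this
      rw [this]
      have h6 : (ℓ : 𝓞 F) ^ k * z = ((ℓ : ℤ) ^ k) • z := by simp [Algebra.smul_def]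
      rw [h6, map_smul]
      simp
    have h7 : ((g i).appr k : ℤ_[ℓ]) = ℓ ^ k * (b.repr z i : ℤ) := by exact_mod_cast h5
    rw [sub_eq_iff_eq_add.1 (hc i), h7]
    exact dvd_add (dvd_mul_right _ _) (dvd_mul_right _ _)
  by_contra hgi
  obtain ⟨n, hn⟩ := exists_pow_lt_of_lt_one (norm_pos_iff.2 hgi) (inv_lt_one_of_one_lt₀ hp)
  obtain ⟨c, hc⟩ := key n
  refine hn.not_ge ?_
  rw [hc, norm_mul, norm_pow, PadicInt.norm_p]
  exact mul_le_of_le_one_right (by positivity) c.2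

/-- Weak approximation of the idempotent at $v$, by the Chinese remainder theorem modulo $k$-th
powers of the primes above $\ell$. -/
theorem exists_tendsto_diagonal_single [DecidableEq (PlaceAbove ℓ F)] (v : PlaceAbove ℓ F) :
    ∃ e : ℕ → 𝓞 F, Tendsto (fun k ↦ diagonal ℓ (e k : F)) atTop (𝓝 (Pi.single v 1)) := by
  have := Fintype.ofFinite (PlaceAbove ℓ F)
  have h : ∀ k : ℕ, ∃ e : 𝓞 F, (e - 1) ∈ v.1.asIdeal ^ k ∧ ∀ w ≠ v, e ∈ w.1.asIdeal ^ k := by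
    intro k
    obtain ⟨y, hy⟩ := IsDedekindDomain.exists_forall_sub_mem_ideal (s := Finset.univ)
      (fun w : PlaceAbove ℓ F ↦ w.1.asIdeal) (fun _ ↦ k) (fun w _ ↦ w.1.prime)
      (fun w _ w' _ hne heq ↦ hne (Subtype.ext (HeightOneSpectrum.ext heq)))
      (fun w ↦ if w.1 = v then 1 else 0)
    refine ⟨y, by simpa using hy v (Finset.mem_univ _), fun w hw ↦ ?_⟩
    simpa [hw] using hy w (Finset.mem_univ _)
  choose e he1 he2 using h
  refine ⟨e, tendsto_pi_nhds.2 fun w ↦ ?_⟩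
  by_cases hw : w = v
  · subst hw
    have := (tendsto_algebraMap_of_mem_pow (F := F) he1).add_const 1
    simpa [diagonal] using this
  · simpa [hw, diagonal] using tendsto_algebraMap_of_mem_pow (F := F) fun k ↦ he2 k w hw

/-- The span is finite dimensional over a complete field, hence closed. It contains $F$, so it also
contains the limits $F\cdot e_v$ for the idempotents $e_v$, and then their closures $F_v$. -/
theorem span_diagonal_integralBasis :
    Submodule.span ℚ_[ℓ] (Set.range fun i ↦ diagonal ℓ (integralBasis F i)) = ⊤ := by
  classical
  have := Fintype.ofFinite (PlaceAbove ℓ F)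
  have (v : PlaceAbove ℓ F) := continuous_smul_padic v
  set W := Submodule.span ℚ_[ℓ] (Set.range fun i ↦ diagonal ℓ (integralBasis F i)) with hW
  have : FiniteDimensional ℚ_[ℓ] W := FiniteDimensional.span_of_finite _ (Set.finite_range _)
  have hcl : IsClosed (W : Set (LocalProduct ℓ F)) := W.closed_of_finiteDimensional
  have hF : ∀ x : F, diagonal ℓ x ∈ W := fun x ↦ by
    rw [← (integralBasis F).sum_repr x, map_sum]
    refine Submodule.sum_mem _ fun i _ ↦ ?_
    rw [← ratCast_smul_diagonal]
    exact Submodule.smul_mem _ _ (Submodule.subset_span ⟨i, rfl⟩)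
  have hs : ∀ (v : PlaceAbove ℓ F) (x : v.1.adicCompletion F), Pi.single v x ∈ W := by
    intro v x
    obtain ⟨e, he⟩ := exists_tendsto_diagonal_single v
    have hx : ∀ x : F, Pi.single v (algebraMap F (v.1.adicCompletion F) x) ∈ W := by
      intro x
      have h1 := he.mul_const (diagonal ℓ x)
      have h2 : Pi.single v (1 : v.1.adicCompletion F) * diagonal ℓ x =
          Pi.single v (algebraMap F (v.1.adicCompletion F) x) := by
        ext w
        by_cases hw : w = v
        · subst hw; simp [diagonal]
        · simp [hw]
      rw [h2] at h1
      refine hcl.mem_of_tendsto h1 (.of_forall fun k ↦ ?_)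
      rw [← map_mul]
      exact hF _
    exact (HeightOneSpectrum.denseRange_algebraMap F v.1).induction_on x
      (hcl.preimage (continuous_single v)) hx
  refine eq_top_iff.2 fun x _ ↦ ?_
  rw [← Finset.univ_sum_single x]
  exact Submodule.sum_mem _ fun v _ ↦ hs v _

/-- An integral basis of `F` is a `ℚ_ℓ`-basis of the product of the completions above `ℓ`. -/
noncomputable def localBasis :
    Module.Basis (Module.Free.ChooseBasisIndex ℤ (𝓞 F)) ℚ_[ℓ] (LocalProduct ℓ F) :=
  .mk linearIndependent_diagonal_integralBasis span_diagonal_integralBasis.ge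

theorem localBasis_apply (i) : localBasis i = diagonal ℓ (integralBasis F i) := by
  simp [localBasis]

instance finiteDimensional_localProduct : FiniteDimensional ℚ_[ℓ] (LocalProduct ℓ F) :=
  Module.Finite.of_basis localBasis

instance finiteDimensional_adicCompletion (v : PlaceAbove ℓ F) :
    FiniteDimensional ℚ_[ℓ] (v.1.adicCompletion F) :=
  Module.Finite.of_surjective (LinearMap.proj (R := ℚ_[ℓ]) (φ := fun w : PlaceAbove ℓ F ↦
    w.1.adicCompletion F) v) (Function.surjective_eval v)

/-- Multiplication by $x$ has the same rational matrix in the integral basis, whether over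
$\mathbb{Q}$ or over $\mathbb{Q}_\ell$. -/
theorem norm_diagonal (x : F) :
    Algebra.norm ℚ_[ℓ] (diagonal ℓ x) = ((Algebra.norm ℚ x : ℚ) : ℚ_[ℓ]) := by
  classical
  rw [Algebra.norm_eq_matrix_det localBasis, Algebra.norm_eq_matrix_det (integralBasis F),
    ← eq_ratCast (algebraMap ℚ ℚ_[ℓ]), RingHom.map_det]
  congr 1
  ext i j
  rw [Algebra.leftMulMatrix_eq_repr_mul, RingHom.mapMatrix_apply, Matrix.map_apply,
    Algebra.leftMulMatrix_eq_repr_mul, localBasis_apply, ← map_mul,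
    ← (integralBasis F).sum_repr (x * _), map_sum]
  simp_rw [← ratCast_smul_diagonal, ← localBasis_apply]
  rw [Module.Basis.repr_sum_self, Module.Basis.sum_repr, eq_ratCast]

end LocalProduct

end LogClass

namespace LogClass

/-! ### Degrees of places and the product formula -/

section PlaceDegree

variable {ℓ : ℕ} [Fact ℓ.Prime] {F : Type*} [Field F] [NumberField F]

attribute [local instance] padicAlgebra

theorem under_int_eq_span (v : PlaceAbove ℓ F) :
    v.1.asIdeal.under ℤ = Ideal.span {(ℓ : ℤ)} := by
  have hp : (Ideal.span {(ℓ : ℤ)}).IsMaximal :=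
    PrincipalIdealRing.isMaximal_of_irreducible
      (Nat.prime_iff_prime_int.1 Fact.out).irreducible
  refine (hp.eq_of_le (Ideal.IsPrime.under ℤ v.1.asIdeal).ne_top ?_).symm
  rw [Ideal.span_singleton_le_iff_mem, Ideal.mem_comap]
  simpa using v.2

theorem absNorm_pow_inertiaDeg_under {E : Type*} [Field E] [NumberField E] [Algebra F E]
    (𝔓 : HeightOneSpectrum (𝓞 E)) :
    Ideal.absNorm (𝔓.under (𝓞 F)).asIdeal ^ 𝔓.asIdeal.inertiaDeg (𝓞 F) =
      Ideal.absNorm 𝔓.asIdeal := by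
  have : 𝔓.asIdeal.LiesOver (𝔓.under (𝓞 F)).asIdeal := ⟨rfl⟩
  have := (𝔓.under (𝓞 F)).isMaximal
  have := 𝔓.isMaximal
  exact Ideal.cardQuot_pow_inertiaDeg _ _

theorem absNorm_under_pow_inertiaDeg (𝔭 : HeightOneSpectrum (𝓞 F)) :
    Ideal.absNorm (𝔭.asIdeal.under ℤ) ^ 𝔭.asIdeal.inertiaDeg ℤ = Ideal.absNorm 𝔭.asIdeal := by
  have := 𝔭.isMaximal
  have : (𝔭.asIdeal.under ℤ).IsMaximal := Ideal.IsMaximal.under ℤ _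
  exact Ideal.cardQuot_pow_inertiaDeg _ _

theorem absNorm_eq_pow (v : PlaceAbove ℓ F) : ∃ f : ℕ, Ideal.absNorm v.1.asIdeal = ℓ ^ f :=
  ⟨_, by rw [← absNorm_under_pow_inertiaDeg, under_int_eq_span]; simp; rfl⟩

theorem coprime_absNorm {𝔭 : HeightOneSpectrum (𝓞 F)} (h : (ℓ : 𝓞 F) ∉ 𝔭.asIdeal) :
    ℓ.Coprime (Ideal.absNorm 𝔭.asIdeal) := by
  have := 𝔭.isMaximal
  obtain ⟨p, n, hn, hp𝔭, hp, hN⟩ := 𝔭.asIdeal.exists_prime_and_absNorm_eq_pow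
  rw [hN]
  refine Nat.Coprime.pow_right n ((Nat.coprime_primes Fact.out hp).2 ?_)
  rintro rfl
  exact h hp𝔭

theorem placeDeg_of_notMem {𝔭 : HeightOneSpectrum (𝓞 F)} (h : (ℓ : 𝓞 F) ∉ 𝔭.asIdeal) :
    placeDeg ℓ 𝔭 = iwasawaLog ℓ (Ideal.absNorm 𝔭.asIdeal) := by
  have h0 := absNorm_under_pow_inertiaDeg 𝔭
  rw [placeDeg, logInertiaDeg, dif_neg h, primeDeg, if_neg, ← h0,
    Nat.cast_pow, iwasawaLog_pow]
  · rw [Nat.cast_ne_zero, Ideal.absNorm_ne_zero_iff_mem_nonZeroDivisors,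
      mem_nonZeroDivisors_iff_ne_zero]
    exact Ideal.IsMaximal.ne_bot_of_isIntegral_int 𝔭.asIdeal |> Ideal.under_ne_bot ℤ
  · intro h1
    have h2 := Ideal.absNorm_mem (𝔭.asIdeal.under ℤ)
    rw [h1, Ideal.mem_comap] at h2
    exact h (by simpa using h2)

theorem placeDeg_of_mem (v : PlaceAbove ℓ F) : placeDeg ℓ v.1 =
    localLogInertiaDeg ℓ ℚ_[ℓ] (v.1.adicCompletion F) * iwasawaLog ℓ (1 + ℓ) := by
  rw [placeDeg, logInertiaDeg, dif_pos v.2, primeDeg, if_pos]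
  rw [under_int_eq_span]; simp

/-- Finite dimensionality excludes the default value $0$ of `Module.finrank`; without it the
division in `logValuation` would be meaningless. -/
theorem localLogInertiaDeg_ne_zero (E L : Type*) [Field E] [Field L] [Algebra ℚ_[ℓ] L]
    [Algebra E L] [FiniteDimensional E L] : localLogInertiaDeg ℓ E L ≠ 0 := by
  have : FiniteDimensional E (IsScalarTower.toAlgHom E L (AlgebraicClosure L)).fieldRange :=
    (AlgHom.toLinearMap (IsScalarTower.toAlgHom E L (AlgebraicClosure L))).finiteDimensional_range
  have : FiniteDimensional E ↥((IsScalarTower.toAlgHom E L (AlgebraicClosure L)).fieldRange ⊓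
      adjoin E (cyclotomicZhat ℚ_[ℓ] (AlgebraicClosure L) : Set (AlgebraicClosure L))) :=
    .of_injective (inclusion inf_le_left).toLinearMap (inclusion_injective inf_le_left)
  exact Module.finrank_pos.ne'

theorem placeDeg_ne_zero (hℓ : ℓ ≠ 2) (v : PlaceAbove ℓ F) : placeDeg ℓ v.1 ≠ 0 := by
  rw [placeDeg_of_mem]
  exact mul_ne_zero (Nat.cast_ne_zero.2 (localLogInertiaDeg_ne_zero _ _))
    (iwasawaLog_one_add_prime_ne_zero hℓ)

theorem placeDeg_mul_logValuation_of_mem (hℓ : ℓ ≠ 2) (v : PlaceAbove ℓ F)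
    (x : v.1.adicCompletion F) :
    logValuation ℓ v.1 x * placeDeg ℓ v.1 = -iwasawaLog ℓ (Algebra.norm ℚ_[ℓ] x) := by
  rw [logValuation, dif_pos v.2, div_mul_cancel₀ _ (placeDeg_ne_zero hℓ v)]

end PlaceDegree

section ProductFormula

variable {ℓ : ℕ} [Fact ℓ.Prime] {F : Type*} [Field F] [NumberField F]

attribute [local instance] padicAlgebra

theorem logValuation_div (𝔭 : HeightOneSpectrum (𝓞 F)) {x y : 𝔭.adicCompletion F} (hx : x ≠ 0)
    (hy : y ≠ 0) : logValuation ℓ 𝔭 (x / y) = logValuation ℓ 𝔭 x - logValuation ℓ 𝔭 y := by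
  unfold logValuation
  split_ifs with h
  · let : Algebra ℚ_[ℓ] (𝔭.adicCompletion F) := (padicMap ℓ 𝔭 h).toAlgebra
    have : FiniteDimensional ℚ_[ℓ] (𝔭.adicCompletion F) :=
      finiteDimensional_adicCompletion ⟨𝔭, h⟩
    have hx' := (Algebra.norm_ne_zero_iff (R := ℚ_[ℓ])).2 hx
    have hy' := (Algebra.norm_ne_zero_iff (R := ℚ_[ℓ])).2 hy
    have hxy : Algebra.norm ℚ_[ℓ] (x / y) = Algebra.norm ℚ_[ℓ] x * (Algebra.norm ℚ_[ℓ] y)⁻¹ := by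
      rw [div_eq_mul_inv, map_mul, Algebra.norm_inv]
    rw [hxy, iwasawaLog_mul hx' (inv_ne_zero hy'), iwasawaLog_inv hy']
    ring
  · rw [map_div₀, WithZero.log_div (by simpa) (by simpa)]
    push_cast
    ring

theorem absNorm_eq_prod {I : Ideal (𝓞 F)} (hI : I ≠ 0) {S : Finset (HeightOneSpectrum (𝓞 F))}
    (hS : ∀ 𝔭 : HeightOneSpectrum (𝓞 F), 𝔭.asIdeal ∣ I → 𝔭 ∈ S) :
    Ideal.absNorm I = ∏ 𝔭 ∈ S, Ideal.absNorm 𝔭.asIdeal ^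
      (Associates.mk 𝔭.asIdeal).count (Associates.mk I).factors := by
  conv_lhs => rw [← Ideal.finprod_heightOneSpectrum_factorization hI]
  rw [finprod_eq_prod_of_mulSupport_subset (s := S), map_prod]
  · exact Finset.prod_congr rfl fun 𝔭 _ ↦ map_pow _ _ _
  · intro 𝔭 h𝔭
    refine hS 𝔭 ?_
    by_contra hd
    refine h𝔭 ?_
    have h0 : (Associates.mk 𝔭.asIdeal).count (Associates.mk I).factors = 0 := by
      by_contra hne
      exact hd ((Associates.count_ne_zero_iff_dvd hI 𝔭.irreducible).1 hne)
    simp [HeightOneSpectrum.maxPowDividing, h0]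

theorem iwasawaLog_absNorm_of_mem (v : PlaceAbove ℓ F) :
    iwasawaLog ℓ (Ideal.absNorm v.1.asIdeal) = 0 := by
  obtain ⟨f, hf⟩ := absNorm_eq_pow v
  rw [hf, Nat.cast_pow, iwasawaLog_pow (by exact_mod_cast (Fact.out : ℓ.Prime).ne_zero),
    iwasawaLog_prime, mul_zero]

theorem logValuation_algebraMap_of_notMem {𝔭 : HeightOneSpectrum (𝓞 F)}
    (h : (ℓ : 𝓞 F) ∉ 𝔭.asIdeal) {a : 𝓞 F} (ha : a ≠ 0) :
    logValuation ℓ 𝔭 (algebraMap F (𝔭.adicCompletion F) a) =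
      ((Associates.mk 𝔭.asIdeal).count (Associates.mk (Ideal.span {a})).factors : ℕ) := by
  have h1 : 𝔭.valuation F (a : F) = 𝔭.intValuation a := 𝔭.valuation_of_algebraMap a
  rw [logValuation, dif_neg h, valued_algebraMap, h1, 𝔭.intValuation_if_neg ha, WithZero.log_exp,
    neg_neg, Int.cast_natCast]

theorem iwasawaLog_natAbs {n : ℤ} (hn : n ≠ 0) :
    iwasawaLog ℓ (n.natAbs : ℚ_[ℓ]) = iwasawaLog ℓ (n : ℚ_[ℓ]) := by
  have hn' : (n.natAbs : ℚ_[ℓ]) ≠ 0 := by simpa using hn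
  rcases Int.natAbs_eq n with h | h
  · conv_rhs => rw [h]
    simp
  · conv_rhs => rw [h]
    rw [Int.cast_neg, Int.cast_natCast, ← neg_one_mul, iwasawaLog_mul (by simp) hn',
      iwasawaLog_neg_one, zero_add]

/-- The places prime to $\ell$ contribute $\mathrm{Log}_\ell|N(a)|$, by factoring the ideal $(a)$
and using $\mathrm{Log}_\ell(\ell)=0$. The places above $\ell$ contribute $-\mathrm{Log}_\ell N(a)$,
by the product of local norms. The sign of $N(a)$ is invisible to the logarithm. -/
theorem sum_logValuation_mul_placeDeg (hℓ : ℓ ≠ 2) {a : 𝓞 F} (ha : a ≠ 0)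
    {S : Finset (HeightOneSpectrum (𝓞 F))}
    (hS : ∀ 𝔭 : HeightOneSpectrum (𝓞 F), a ∈ 𝔭.asIdeal → 𝔭 ∈ S)
    (hS' : ∀ 𝔭 : HeightOneSpectrum (𝓞 F), (ℓ : 𝓞 F) ∈ 𝔭.asIdeal → 𝔭 ∈ S) :
    ∑ 𝔭 ∈ S, logValuation ℓ 𝔭 (algebraMap F (𝔭.adicCompletion F) a) * placeDeg ℓ 𝔭 = 0 := by
  classical
  have := Fintype.ofFinite (PlaceAbove ℓ F)
  have hI : Ideal.span {a} ≠ 0 := by simpa using ha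
  have haF : (a : F) ≠ 0 := by simpa using ha
  have hN : (Algebra.norm ℤ a) ≠ 0 := Algebra.norm_ne_zero_iff.2 ha
  -- The sum may run over all of `S`: at a place above $\ell$ the norm is a power of $\ell$ and has
  -- logarithm $0$.
  have h1 : ∑ 𝔭 ∈ S, (((Associates.mk 𝔭.asIdeal).count (Associates.mk (Ideal.span {a})).factors : ℕ)
      : ℚ_[ℓ]) * iwasawaLog ℓ (Ideal.absNorm 𝔭.asIdeal) = iwasawaLog ℓ (Algebra.norm ℤ a) := by
    have h2 := absNorm_eq_prod hI (S := S) fun 𝔭 h ↦ hS 𝔭 (Ideal.dvd_span_singleton.1 h)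
    have hne : ∀ 𝔭 : HeightOneSpectrum (𝓞 F), (Ideal.absNorm 𝔭.asIdeal : ℚ_[ℓ]) ≠ 0 := fun 𝔭 ↦ by
      have := HeightOneSpectrum.one_lt_absNorm 𝔭
      exact Nat.cast_ne_zero.2 (by omega)
    rw [Ideal.absNorm_span_singleton] at h2
    rw [← iwasawaLog_natAbs hN, h2]
    push_cast
    rw [iwasawaLog_prod _ _ fun 𝔭 _ ↦ pow_ne_zero _ (hne 𝔭)]
    exact Finset.sum_congr rfl fun 𝔭 _ ↦ (iwasawaLog_pow (hne 𝔭) _).symm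
  have h3 : ∑ v : PlaceAbove ℓ F, iwasawaLog ℓ
      (Algebra.norm ℚ_[ℓ] (algebraMap F (v.1.adicCompletion F) a)) =
      iwasawaLog ℓ (Algebra.norm ℤ a) := by
    have h4 := norm_diagonal (ℓ := ℓ) (a : F)
    rw [norm_pi] at h4
    rw [← iwasawaLog_prod]
    · refine congrArg _ (h4.trans ?_)
      rw [← Algebra.coe_norm_int]
      simp
    · intro v _
      rw [Algebra.norm_ne_zero_iff]
      simpa using haF
  have h5 : ∀ 𝔭 ∈ S, logValuation ℓ 𝔭 (algebraMap F (𝔭.adicCompletion F) a) * placeDeg ℓ 𝔭 =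
      (((Associates.mk 𝔭.asIdeal).count (Associates.mk (Ideal.span {a})).factors : ℕ) : ℚ_[ℓ]) *
        iwasawaLog ℓ (Ideal.absNorm 𝔭.asIdeal) +
      if (ℓ : 𝓞 F) ∈ 𝔭.asIdeal then
        logValuation ℓ 𝔭 (algebraMap F (𝔭.adicCompletion F) a) * placeDeg ℓ 𝔭 else 0 := by
    intro 𝔭 _
    split_ifs with h
    · rw [iwasawaLog_absNorm_of_mem ⟨𝔭, h⟩, mul_zero, zero_add]
    · rw [logValuation_algebraMap_of_notMem h ha, placeDeg_of_notMem h, add_zero]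
  rw [Finset.sum_congr rfl h5, Finset.sum_add_distrib, h1, ← h3, ← Finset.sum_filter,
    Finset.sum_subtype (p := fun 𝔭 : HeightOneSpectrum (𝓞 F) ↦ (ℓ : 𝓞 F) ∈ 𝔭.asIdeal)]
  · rw [← Finset.sum_add_distrib]
    refine Finset.sum_eq_zero fun v _ ↦ ?_
    rw [placeDeg_mul_logValuation_of_mem hℓ v, add_neg_cancel]
  · intro 𝔭
    rw [Finset.mem_filter]
    exact ⟨fun h ↦ h.2, fun h ↦ ⟨hS' 𝔭 h, h⟩⟩

theorem logDegree_eq_zero_of_mem (hℓ : ℓ ≠ 2) {D : LogDiv ℓ F} (hD : D ∈ principalLogDiv ℓ F) :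
    logDegree ℓ F D = 0 := by
  classical
  refine (Submodule.span_le (p := LinearMap.ker (logDegree ℓ F))).2 ?_ hD
  rintro D ⟨x, hx⟩
  -- The product formula was proved for integers; a quotient of two integers follows by subtraction
  -- over a common finite set of places.
  obtain ⟨a, b, hb, hab⟩ := IsFractionRing.div_surjective (A := 𝓞 F) (x : F)
  have hb0 : b ≠ 0 := nonZeroDivisors.ne_zero hb
  have ha0 : a ≠ 0 := by
    rintro rfl
    exact x.ne_zero (by rw [← hab, map_zero, zero_div])
  have hfin : ∀ c : 𝓞 F, c ≠ 0 → {𝔭 : HeightOneSpectrum (𝓞 F) | c ∈ 𝔭.asIdeal}.Finite := by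
    intro c hc
    have h : Ideal.span {c} ≠ 0 := by simpa using hc
    exact (Ideal.finite_factors h).subset fun v hv ↦ Ideal.dvd_span_singleton.2 hv
  have hl : (ℓ : 𝓞 F) ≠ 0 := by exact_mod_cast (Fact.out : ℓ.Prime).ne_zero
  let S : Finset (HeightOneSpectrum (𝓞 F)) :=
    D.support ∪ (hfin a ha0).toFinset ∪ (hfin b hb0).toFinset ∪ (hfin ℓ hl).toFinset
  have hsum : logDegree ℓ F D = ∑ 𝔭 ∈ S, (D 𝔭 : ℚ_[ℓ]) * placeDeg ℓ 𝔭 := by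
    rw [logDegree, Finsupp.linearCombination_apply, Finsupp.sum_of_support_subset D (s := S)]
    · rfl
    · intro 𝔭 h
      simp only [S, Finset.mem_union]
      tauto
    · simp
  rw [SetLike.mem_coe, LinearMap.mem_ker, hsum]
  have h1 := sum_logValuation_mul_placeDeg hℓ ha0 (S := S)
    (fun 𝔭 h ↦ by simp [S, h]) (fun 𝔭 h ↦ by simp [S, h])
  have h2 := sum_logValuation_mul_placeDeg hℓ hb0 (S := S)
    (fun 𝔭 h ↦ by simp [S, h]) (fun 𝔭 h ↦ by simp [S, h])
  refine Eq.trans ?_ ((congrArg₂ (· - ·) h1 h2).trans (sub_zero 0))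
  rw [← Finset.sum_sub_distrib]
  refine Finset.sum_congr rfl fun 𝔭 _ ↦ ?_
  rw [hx 𝔭, ← hab, map_div₀, logValuation_div, sub_mul]
  · simpa using ha0
  · simpa using hb0

end ProductFormula

end LogClass

namespace LogClass

open Module

/-! ### Logarithmic inertia degrees in towers and the degree of a norm -/

section Compositum

variable {k Ω : Type*} [Field k] [Field Ω] [Algebra k Ω]

/-- Since $B$ is Galois, $A$ and $B$ are linearly disjoint over $A\cap B$. -/
theorem finrank_sup_mul_finrank_inf (A B : IntermediateField k Ω) [FiniteDimensional k A]
    [FiniteDimensional k B] [IsGalois k B] :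
    finrank k ↥(A ⊔ B) * finrank k ↥(A ⊓ B) = finrank k A * finrank k B := by
  let D := A ⊓ B
  let A' := extendScalars (inf_le_left : D ≤ A)
  let B' := extendScalars (inf_le_right : D ≤ B)
  have hB : IsGalois k B' := ‹IsGalois k B›
  have : IsGalois D B' := .tower_top_of_isGalois k D B'
  have hAk : FiniteDimensional k A' := ‹FiniteDimensional k A›
  have hBk : FiniteDimensional k B' := ‹FiniteDimensional k B›
  have : FiniteDimensional D A' := .right k D A'
  have : FiniteDimensional D B' := .right k D B'
  have hd : B'.LinearDisjoint A' := by
    refine LinearDisjoint.of_inf_eq_bot ?_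
    rw [eq_bot_iff]
    rintro x ⟨hx1, hx2⟩
    exact mem_bot.2 ⟨⟨x, hx2, hx1⟩, rfl⟩
  have h := hd.finrank_sup
  have h1 : B' ⊔ A' = extendScalars (inf_le_left.trans le_sup_left : D ≤ A ⊔ B) := by
    rw [sup_comm]; exact extendScalars_sup ..
  rw [h1, ← relfinrank_eq_finrank_of_le, ← relfinrank_eq_finrank_of_le,
    ← relfinrank_eq_finrank_of_le] at h
  rw [← finrank_bot_mul_relfinrank (inf_le_left.trans le_sup_left : D ≤ A ⊔ B),
    ← finrank_bot_mul_relfinrank (inf_le_left : D ≤ A),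
    ← finrank_bot_mul_relfinrank (inf_le_right : D ≤ B), h]
  ring

/-- The modular law fails for general fields. It holds here because the finite subextensions of $C$
are Galois, so that degrees of composita can be counted. -/
theorem inf_sup_eq_sup_inf [Algebra.IsAlgebraic k Ω] {E L C : IntermediateField k Ω} (hEL : E ≤ L)
    [FiniteDimensional k L]
    (hC : ∀ M ≤ C, FiniteDimensional k M → IsGalois k M) :
    L ⊓ (E ⊔ C) = E ⊔ (L ⊓ C) := by
  have fin_le : ∀ {M N : IntermediateField k Ω}, M ≤ N → FiniteDimensional k N →
      FiniteDimensional k M := fun h _ ↦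
    .of_injective (inclusion h).toLinearMap (inclusion_injective h)
  refine le_antisymm ?_ (sup_le (le_inf hEL le_sup_left) (inf_le_inf_left _ le_sup_right))
  rintro x ⟨hxL, hx⟩
  obtain ⟨M, hMC, hM, hxM⟩ : ∃ M ≤ C, FiniteDimensional k M ∧ x ∈ E ⊔ M := by
    classical
    change x ∈ adjoin k _ at hx
    obtain ⟨T, hT, hxT⟩ := exists_finset_of_mem_adjoin hx
    refine ⟨adjoin k (T.filter (· ∈ C)), adjoin_le_iff.2 fun y hy ↦ ?_,
      finiteDimensional_adjoin fun y _ ↦ Algebra.IsIntegral.isIntegral y,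
      (adjoin_le_iff.2 fun y hy ↦ ?_ : adjoin k (T : Set Ω) ≤ _) hxT⟩
    · exact (Finset.mem_filter.1 hy).2
    · rcases hT hy with h | h
      · exact (le_sup_left : E ≤ _) h
      · exact (le_sup_right : _ ≤ E ⊔ adjoin k _)
          (subset_adjoin k _ (Finset.mem_coe.2 (Finset.mem_filter.2 ⟨hy, h⟩)))
  -- It suffices that $F=E(F\cap M)$. As $FM=EM$, the degree formula for the pairs $(F,M)$, $(E,M)$
  -- and $(E,F\cap M)$ gives both sides the same degree.
  let F := E ⊔ k⟮x⟯
  have hFL : F ≤ L := sup_le hEL (adjoin_simple_le_iff.2 hxL)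
  have hFM : F ≤ E ⊔ M := sup_le le_sup_left (adjoin_simple_le_iff.2 hxM)
  have hF := fin_le hFL inferInstance
  have hE := fin_le hEL inferInstance
  have h1 : F ⊔ M = E ⊔ M :=
    le_antisymm (sup_le hFM le_sup_right) (sup_le_sup_right le_sup_left _)
  have := hC M hMC hM
  have hFi := fin_le (inf_le_right : F ⊓ M ≤ M) hM
  have := hC (F ⊓ M) (inf_le_right.trans hMC) hFi
  have h2 := finrank_sup_mul_finrank_inf F M
  have h3 := finrank_sup_mul_finrank_inf E M
  have h4 := finrank_sup_mul_finrank_inf E (F ⊓ M)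
  have h5 : E ⊓ (F ⊓ M) = E ⊓ M := by rw [← inf_assoc, inf_eq_left.2 (le_sup_left : E ≤ F)]
  rw [h1] at h2
  rw [h5] at h4
  have hEi := fin_le (inf_le_right : E ⊓ M ≤ M) hM
  have p1 : 0 < finrank k M := finrank_pos
  have p2 : 0 < finrank k ↥(E ⊓ M) := finrank_pos
  have h6 : finrank k ↥(E ⊔ (F ⊓ M)) = finrank k F := by
    refine Nat.eq_of_mul_eq_mul_right (Nat.mul_pos p1 p2) ?_
    calc _ = finrank k ↥(E ⊔ (F ⊓ M)) * finrank k ↥(E ⊓ M) * finrank k M := by ring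
      _ = finrank k ↥(F ⊓ M) * (finrank k E * finrank k M) := by rw [h4]; ring
      _ = (finrank k ↥(E ⊔ M) * finrank k ↥(F ⊓ M)) * finrank k ↥(E ⊓ M) := by rw [← h3]; ring
      _ = _ := by rw [h2]; ring
  have h7 : E ⊔ (F ⊓ M) = F := eq_of_le_of_finrank_eq (sup_le le_sup_left inf_le_left) h6
  have hxF : x ∈ F := (le_sup_right : k⟮x⟯ ≤ F) (mem_adjoin_simple_self k x)
  rw [← h7] at hxF
  exact (sup_le_sup_left (inf_le_inf hFL hMC) E) hxF

theorem finrank_inf_sup_mul [Algebra.IsAlgebraic k Ω] {E L C : IntermediateField k Ω} (hEL : E ≤ L)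
    [FiniteDimensional k L] (hC : ∀ M ≤ C, FiniteDimensional k M → IsGalois k M) :
    finrank k ↥(L ⊓ (E ⊔ C)) * finrank k ↥(E ⊓ C) = finrank k E * finrank k ↥(L ⊓ C) := by
  have : FiniteDimensional k E :=
    .of_injective (inclusion hEL).toLinearMap (inclusion_injective hEL)
  have h : FiniteDimensional k ↥(L ⊓ C) := .of_injective
    (inclusion (inf_le_left : L ⊓ C ≤ L)).toLinearMap (inclusion_injective inf_le_left)
  have := hC (L ⊓ C) inf_le_right h
  have h1 := finrank_sup_mul_finrank_inf E (L ⊓ C)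
  rwa [← inf_sup_eq_sup_inf hEL hC, ← inf_assoc, inf_eq_left.2 hEL] at h1

end Compositum

section Cyclotomic

variable {k Ω Ω' : Type*} [Field k] [Field Ω] [Algebra k Ω] [Field Ω'] [Algebra k Ω']

theorem mem_cyclotomicZq {q : ℕ} {x : Ω} : x ∈ cyclotomicZq q k Ω ↔
    ∃ hx : x ∈ adjoin k {ζ : Ω | ∃ n : ℕ, ζ ^ q ^ n = 1},
      ∀ σ : Gal(adjoin k {ζ : Ω | ∃ n : ℕ, ζ ^ q ^ n = 1}/k), IsOfFinOrder σ →
        σ ⟨x, hx⟩ = ⟨x, hx⟩ := by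
  constructor
  · intro h
    have hx := lift_le _ h
    refine ⟨hx, fun σ hσ ↦ ?_⟩
    exact (mem_lift (⟨x, hx⟩ : adjoin k {ζ : Ω | ∃ n : ℕ, ζ ^ q ^ n = 1})).1 h
      ⟨σ, Subgroup.subset_closure hσ⟩
  · rintro ⟨hx, h⟩
    refine (mem_lift (⟨x, hx⟩ : adjoin k {ζ : Ω | ∃ n : ℕ, ζ ^ q ^ n = 1})).2 ?_
    rintro ⟨σ, hσ⟩
    change σ _ = _
    induction hσ using Subgroup.closure_induction with
    | mem σ hσ => exact h σ hσ
    | one => rfl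
    | mul σ τ _ _ h1 h2 => rw [AlgEquiv.mul_apply, h2, h1]
    | inv σ _ h1 => rw [AlgEquiv.aut_inv, AlgEquiv.symm_apply_eq, h1]

theorem map_cyclotomicZq_le (q : ℕ) (φ : Ω ≃ₐ[k] Ω') :
    (cyclotomicZq q k Ω).map φ.toAlgHom ≤ cyclotomicZq q k Ω' := by
  have hA : (adjoin k {ζ : Ω | ∃ n : ℕ, ζ ^ q ^ n = 1}).map φ.toAlgHom =
      adjoin k {ζ : Ω' | ∃ n : ℕ, ζ ^ q ^ n = 1} := by
    rw [adjoin_map]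
    congr 1
    ext ζ
    constructor
    · rintro ⟨ζ, ⟨n, hn⟩, rfl⟩
      exact ⟨n, by rw [← map_pow, hn, map_one]⟩
    · rintro ⟨n, hn⟩
      exact ⟨φ.symm ζ, ⟨n, by rw [← map_pow, hn, map_one]⟩, φ.apply_symm_apply ζ⟩
  let e : adjoin k {ζ : Ω | ∃ n : ℕ, ζ ^ q ^ n = 1} ≃ₐ[k]
      adjoin k {ζ : Ω' | ∃ n : ℕ, ζ ^ q ^ n = 1} :=
    (intermediateFieldMap φ _).trans (equivOfEq hA)
  rintro _ ⟨x, hx, rfl⟩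
  obtain ⟨hxA, h⟩ := mem_cyclotomicZq.1 hx
  refine mem_cyclotomicZq.2 ⟨(e ⟨x, hxA⟩).2, fun σ hσ ↦ ?_⟩
  have h1 : IsOfFinOrder ((AlgEquiv.autCongr e).symm σ) :=
    MonoidHom.isOfFinOrder (AlgEquiv.autCongr e).symm.toMonoidHom hσ
  have h2 := h _ h1
  have h3 : e.symm (σ (e ⟨x, hxA⟩)) = ⟨x, hxA⟩ := h2
  exact e.symm_apply_eq.1 h3

theorem map_cyclotomicZhat_le (φ : Ω ≃ₐ[k] Ω') :
    (cyclotomicZhat k Ω).map φ.toAlgHom ≤ cyclotomicZhat k Ω' := by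
  rw [cyclotomicZhat, IntermediateField.map_iSup]
  exact iSup_mono fun q ↦ map_cyclotomicZq_le q φ

/-- Inertia degrees are defined inside different algebraic closures; this allows them to be compared
in a single one. -/
theorem map_cyclotomicZhat (φ : Ω ≃ₐ[k] Ω') :
    (cyclotomicZhat k Ω).map φ.toAlgHom = cyclotomicZhat k Ω' := by
  refine le_antisymm (map_cyclotomicZhat_le φ) fun x hx ↦ ?_
  exact ⟨φ.symm x, map_cyclotomicZhat_le φ.symm ⟨x, hx, rfl⟩, φ.apply_symm_apply x⟩

theorem isAbelianGalois_adjoin_roots_of_unity [IsAlgClosed Ω] [CharZero Ω] (S : Set ℕ) :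
    IsAbelianGalois k (adjoin k {ζ : Ω | ∃ n ∈ S, n ≠ 0 ∧ ζ ^ n = 1}) := by
  have : IsCyclotomicExtension S k (adjoin k {ζ : Ω | ∃ n ∈ S, n ≠ 0 ∧ ζ ^ n = 1}) := by
    refine IntermediateField.isCyclotomicExtension_adjoin_of_exists_isPrimitiveRoot S k Ω
      fun n _ hn ↦ ?_
    have : NeZero (n : Ω) := ⟨Nat.cast_ne_zero.2 hn⟩
    exact HasEnoughRootsOfUnity.exists_primitiveRoot Ω n
  exact IsCyclotomicExtension.isAbelianGalois S k _

theorem cyclotomicZq_le_adjoin (q : ℕ) [NeZero q] : cyclotomicZq q k Ω ≤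
    adjoin k {ζ : Ω | ∃ n ∈ Set.univ, n ≠ 0 ∧ ζ ^ n = 1} :=
  (lift_le _).trans (adjoin.mono _ _ _ fun _ ⟨n, hn⟩ ↦
    ⟨q ^ n, trivial, pow_ne_zero _ (NeZero.ne q), hn⟩)

/-- All roots of unity together generate an abelian extension, and each of its subextensions is
Galois. -/
theorem isGalois_of_le_cyclotomicZhat [IsAlgClosed Ω] [CharZero Ω] {M : IntermediateField k Ω}
    (hM : M ≤ cyclotomicZhat k Ω) : IsGalois k M := by
  have h : cyclotomicZhat k Ω ≤ adjoin k {ζ : Ω | ∃ n ∈ Set.univ, n ≠ 0 ∧ ζ ^ n = 1} :=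
    iSup_le fun q ↦ have : NeZero (q : ℕ) := ⟨q.2.ne_zero⟩; cyclotomicZq_le_adjoin q
  have := isAbelianGalois_adjoin_roots_of_unity (k := k) (Ω := Ω) Set.univ
  exact (IsAbelianGalois.of_algHom (inclusion (hM.trans h))).toIsGalois

end Cyclotomic

section LocalLogInertiaDeg

variable {ℓ : ℕ} [Fact ℓ.Prime]

theorem finrank_mul_localLogInertiaDeg (E L : Type*) [Field E] [Field L] [Algebra ℚ_[ℓ] E]
    [Algebra ℚ_[ℓ] L] [Algebra E L] [IsScalarTower ℚ_[ℓ] E L] :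
    finrank ℚ_[ℓ] E * localLogInertiaDeg ℓ E L = finrank ℚ_[ℓ]
      ↥((IsScalarTower.toAlgHom ℚ_[ℓ] L (AlgebraicClosure L)).fieldRange ⊓
        ((IsScalarTower.toAlgHom ℚ_[ℓ] E (AlgebraicClosure L)).fieldRange ⊔
          cyclotomicZhat ℚ_[ℓ] (AlgebraicClosure L))) := by
  set Ω := AlgebraicClosure L
  set C := cyclotomicZhat ℚ_[ℓ] Ω
  set X := (IsScalarTower.toAlgHom E L Ω).fieldRange ⊓ adjoin E (C : Set Ω) with hX
  have h : X.restrictScalars ℚ_[ℓ] = (IsScalarTower.toAlgHom ℚ_[ℓ] L Ω).fieldRange ⊓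
      ((IsScalarTower.toAlgHom ℚ_[ℓ] E Ω).fieldRange ⊔ C) := by
    have h1 : (adjoin E (C : Set Ω)).restrictScalars ℚ_[ℓ] =
        (IsScalarTower.toAlgHom ℚ_[ℓ] E Ω).fieldRange ⊔ C := by
      apply le_antisymm
      · let T : IntermediateField E Ω :=
          ((IsScalarTower.toAlgHom ℚ_[ℓ] E Ω).fieldRange ⊔ C).toSubfield.toIntermediateField
            fun x ↦ (le_sup_left : (IsScalarTower.toAlgHom ℚ_[ℓ] E Ω).fieldRange ≤ _) ⟨x, rfl⟩
        have hT : adjoin E (C : Set Ω) ≤ T :=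
          adjoin_le_iff.2 fun x hx ↦ (le_sup_right : C ≤ _) hx
        exact hT
      · refine sup_le ?_ fun x hx ↦ subset_adjoin E _ hx
        rintro _ ⟨x, rfl⟩
        exact (adjoin E (C : Set Ω)).algebraMap_mem x
    rw [← h1]
    rfl
  rw [← h]
  exact finrank_mul_finrank ℚ_[ℓ] E X

theorem localLogInertiaDeg_base (L : Type*) [Field L] [Algebra ℚ_[ℓ] L] :
    localLogInertiaDeg ℓ ℚ_[ℓ] L = finrank ℚ_[ℓ]
      ↥((IsScalarTower.toAlgHom ℚ_[ℓ] L (AlgebraicClosure L)).fieldRange ⊓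
          cyclotomicZhat ℚ_[ℓ] (AlgebraicClosure L)) := by
  rw [localLogInertiaDeg, adjoin_self]

theorem localLogInertiaDeg_base_eq_of_isAlgClosure (E Ω : Type*) [Field E] [Field Ω]
    [Algebra ℚ_[ℓ] E] [Algebra ℚ_[ℓ] Ω] [Algebra E Ω] [IsScalarTower ℚ_[ℓ] E Ω]
    [IsAlgClosure E Ω] : localLogInertiaDeg ℓ ℚ_[ℓ] E = finrank ℚ_[ℓ]
      ↥((IsScalarTower.toAlgHom ℚ_[ℓ] E Ω).fieldRange ⊓ cyclotomicZhat ℚ_[ℓ] Ω) := by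
  rw [localLogInertiaDeg_base]
  let φ := (IsAlgClosure.equiv E (AlgebraicClosure E) Ω).restrictScalars ℚ_[ℓ]
  have h : ((IsScalarTower.toAlgHom ℚ_[ℓ] E (AlgebraicClosure E)).fieldRange ⊓
      cyclotomicZhat ℚ_[ℓ] (AlgebraicClosure E)).map φ.toAlgHom =
      (IsScalarTower.toAlgHom ℚ_[ℓ] E Ω).fieldRange ⊓ cyclotomicZhat ℚ_[ℓ] Ω := by
    rw [IntermediateField.map_inf, map_cyclotomicZhat, AlgHom.map_fieldRange]
    congr 2
    ext x
    exact (IsAlgClosure.equiv E (AlgebraicClosure E) Ω).commutes x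
  rw [← h]
  exact (intermediateFieldMap φ _).toLinearEquiv.finrank_eq

/-- With $C$ the cyclotomic $\widehat{\mathbb{Z}}$-extension, this is $[L\cap
EC:\mathbb{Q}_\ell]\,[E\cap C:\mathbb{Q}_\ell]=[E:\mathbb{Q}_\ell]\,[L\cap C:\mathbb{Q}_\ell]$ after
cancelling $[E:\mathbb{Q}_\ell]$. -/
theorem localLogInertiaDeg_mul (E L : Type*) [Field E] [Field L] [Algebra ℚ_[ℓ] E]
    [Algebra ℚ_[ℓ] L] [Algebra E L] [IsScalarTower ℚ_[ℓ] E L] [FiniteDimensional ℚ_[ℓ] L] :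
    localLogInertiaDeg ℓ E L * localLogInertiaDeg ℓ ℚ_[ℓ] E = localLogInertiaDeg ℓ ℚ_[ℓ] L := by
  have : FiniteDimensional ℚ_[ℓ] E := .left ℚ_[ℓ] E L
  have : FiniteDimensional E L := .right ℚ_[ℓ] E L
  have : Algebra.IsAlgebraic E (AlgebraicClosure L) := .trans E L _
  have : Algebra.IsAlgebraic ℚ_[ℓ] (AlgebraicClosure L) := .trans ℚ_[ℓ] L _
  have : IsAlgClosure E (AlgebraicClosure L) := ⟨inferInstance, inferInstance⟩
  have : CharZero (AlgebraicClosure L) := charZero_of_injective_algebraMap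
    (algebraMap ℚ_[ℓ] (AlgebraicClosure L)).injective
  have : FiniteDimensional ℚ_[ℓ] (IsScalarTower.toAlgHom ℚ_[ℓ] L (AlgebraicClosure L)).fieldRange :=
    (IsScalarTower.toAlgHom ℚ_[ℓ] L (AlgebraicClosure L)).toLinearMap.finiteDimensional_range
  have h := finrank_inf_sup_mul (k := ℚ_[ℓ])
    (E := (IsScalarTower.toAlgHom ℚ_[ℓ] E (AlgebraicClosure L)).fieldRange)
    (L := (IsScalarTower.toAlgHom ℚ_[ℓ] L (AlgebraicClosure L)).fieldRange)
    (C := cyclotomicZhat ℚ_[ℓ] (AlgebraicClosure L))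
    (by
      rintro _ ⟨x, rfl⟩
      exact ⟨algebraMap E L x, (IsScalarTower.algebraMap_apply E L _ x).symm⟩)
    fun M hM _ ↦ isGalois_of_le_cyclotomicZhat hM
  rw [← finrank_mul_localLogInertiaDeg, ← localLogInertiaDeg_base,
    ← localLogInertiaDeg_base_eq_of_isAlgClosure] at h
  have h1 : finrank ℚ_[ℓ] (IsScalarTower.toAlgHom ℚ_[ℓ] E (AlgebraicClosure L)).fieldRange =
      finrank ℚ_[ℓ] E :=
    (AlgEquiv.ofInjectiveField
      (IsScalarTower.toAlgHom ℚ_[ℓ] E (AlgebraicClosure L))).toLinearEquiv.finrank_eq.symm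
  rw [h1, mul_assoc] at h
  exact Nat.eq_of_mul_eq_mul_left finrank_pos h

end LocalLogInertiaDeg

section NormDegree

variable {ℓ : ℕ} [Fact ℓ.Prime] {F E : Type*} [Field F] [NumberField F] [Field E] [NumberField E]
  [Algebra F E]

theorem natCast_mem_under_iff (𝔓 : HeightOneSpectrum (𝓞 E)) :
    (ℓ : 𝓞 F) ∈ (𝔓.under (𝓞 F)).asIdeal ↔ (ℓ : 𝓞 E) ∈ 𝔓.asIdeal := by
  rw [HeightOneSpectrum.under_asIdeal, Ideal.mem_comap, map_natCast]

theorem relLogInertiaDeg_mul_placeDeg (𝔓 : HeightOneSpectrum (𝓞 E)) :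
    relLogInertiaDeg ℓ F 𝔓 * placeDeg ℓ (𝔓.under (𝓞 F)) = placeDeg ℓ 𝔓 := by
  by_cases h : (ℓ : 𝓞 E) ∈ 𝔓.asIdeal
  · have h' := (natCast_mem_under_iff (F := F) 𝔓).2 h
    rw [relLogInertiaDeg, dif_pos h, placeDeg_of_mem ⟨𝔓, h⟩, placeDeg_of_mem ⟨_, h'⟩, ← mul_assoc,
      ← Nat.cast_mul]
    let := (padicMap ℓ 𝔓 h).toAlgebra
    have : 𝔓.asIdeal.LiesOver (𝔓.under (𝓞 F)).asIdeal := ⟨rfl⟩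
    let := (completionMap F E (𝔓.under (𝓞 F)) 𝔓).toAlgebra
    let := (padicMap ℓ (𝔓.under (𝓞 F)) h').toAlgebra
    have : FiniteDimensional ℚ_[ℓ] (𝔓.adicCompletion E) := finiteDimensional_adicCompletion ⟨𝔓, h⟩
    have : IsScalarTower ℚ_[ℓ] ((𝔓.under (𝓞 F)).adicCompletion F) (𝔓.adicCompletion E) :=
      .of_algebraMap_eq fun x ↦ (completionMap_padicMap h' h x).symm
    congr 2
    exact localLogInertiaDeg_mul ((𝔓.under (𝓞 F)).adicCompletion F) (𝔓.adicCompletion E)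
  · have h' := (natCast_mem_under_iff (F := F) 𝔓).not.2 h
    rw [relLogInertiaDeg, dif_neg h, placeDeg_of_notMem h, placeDeg_of_notMem h',
      ← absNorm_pow_inertiaDeg_under (F := F) 𝔓, Nat.cast_pow, iwasawaLog_pow]
    have := HeightOneSpectrum.one_lt_absNorm (𝔓.under (𝓞 F))
    exact Nat.cast_ne_zero.2 (by omega)

theorem logDegree_logNorm (D : LogDiv ℓ E) : logDegree ℓ F (logNorm ℓ F E D) = logDegree ℓ E D := by
  have h : logDegree ℓ F ∘ₗ logNorm ℓ F E = logDegree ℓ E := by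
    refine Finsupp.lhom_ext' fun 𝔓 ↦ LinearMap.ext_ring ?_
    simp [logDegree, logNorm]
    rw [← relLogInertiaDeg_mul_placeDeg (F := F) 𝔓, Algebra.smul_def]
    simp
  exact LinearMap.congr_fun h D

end NormDegree

end LogClass

namespace LogClass

open Module

/-! ### Euler products and the pole of the Dedekind zeta function -/

section EulerProduct

open ENNReal

/-- The formal Euler product `∏_i (1 - w i)⁻¹`, expanded as a sum over finitely supported
exponents. -/
noncomputable def eulerSum {ι : Type*} (w : ι → ℝ≥0∞) : ℝ≥0∞ :=
  ∑' f : ι →₀ ℕ, f.prod fun i n ↦ w i ^ n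

variable {ι κ : Type*}

/-- With values in $[0,\infty]$, factors can be split off, dropped or compared with no convergence
to check. -/
theorem eulerSum_sum (w : ι ⊕ κ → ℝ≥0∞) :
    eulerSum w = eulerSum (w ∘ Sum.inl) * eulerSum (w ∘ Sum.inr) := by
  rw [eulerSum, ← Finsupp.sumFinsuppEquivProdFinsupp.symm.tsum_eq, ENNReal.tsum_prod', eulerSum,
    ← ENNReal.tsum_mul_right]
  refine tsum_congr fun f ↦ ?_
  rw [eulerSum, ← ENNReal.tsum_mul_left]
  refine tsum_congr fun g ↦ ?_
  exact Finsupp.prod_sumElim f g _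

theorem eulerSum_comp_le (e : ι ↪ κ) (w : κ → ℝ≥0∞) : eulerSum (w ∘ e) ≤ eulerSum w := by
  have h := ENNReal.tsum_comp_le_tsum_of_injective (Finsupp.embDomain_injective (M := ℕ) e)
    fun f ↦ f.prod fun i n ↦ w i ^ n
  simpa only [eulerSum, Finsupp.prod_embDomain, Function.comp_apply] using h

theorem eulerSum_comp_equiv (e : ι ≃ κ) (w : κ → ℝ≥0∞) : eulerSum (w ∘ e) = eulerSum w := by
  refine le_antisymm (eulerSum_comp_le e.toEmbedding w) ?_
  have h := eulerSum_comp_le e.symm.toEmbedding (w ∘ e)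
  have h2 : (w ∘ e) ∘ e.symm.toEmbedding = w := by ext; simp
  rwa [h2] at h

theorem eulerSum_mono {w w' : ι → ℝ≥0∞} (h : ∀ i, w i ≤ w' i) : eulerSum w ≤ eulerSum w' :=
  ENNReal.tsum_le_tsum fun _ ↦ Finset.prod_le_prod' fun _ _ ↦ pow_le_pow_left' (h _) _

theorem eulerSum_unique [Unique ι] (w : ι → ℝ≥0∞) : eulerSum w = (1 - w default)⁻¹ := by
  rw [eulerSum, ← ENNReal.tsum_geometric, ← (Finsupp.uniqueEquiv default).symm.tsum_eq]
  refine tsum_congr fun n ↦ ?_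
  simp

theorem eulerSum_isEmpty [IsEmpty ι] (w : ι → ℝ≥0∞) : eulerSum w = 1 := by
  rw [eulerSum, tsum_eq_single 0 fun f hf ↦ (hf (Subsingleton.elim _ _)).elim]
  simp

theorem eulerSum_le_two_pow [Finite ι] (w : ι → ℝ≥0∞) (hw : ∀ i, w i ≤ 2⁻¹) :
    eulerSum w ≤ 2 ^ Nat.card ι := by
  induction ι using Finite.induction_empty_option with
  | of_equiv e ih =>
    rw [← eulerSum_comp_equiv e, ← Nat.card_congr e]
    exact ih _ fun i ↦ hw _
  | h_empty => simp [eulerSum_isEmpty]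
  | @h_option α _ ih =>
    rw [← eulerSum_comp_equiv (Equiv.optionEquivSumPUnit.{0} α).symm, eulerSum_sum,
      Finite.card_option, pow_succ]
    refine mul_le_mul' (ih _ fun i ↦ hw _) ?_
    rw [eulerSum_unique]
    refine (ENNReal.inv_le_inv.2 (tsub_le_tsub_left (hw _) 1)).trans ?_
    rw [ENNReal.one_sub_inv_two, inv_inv]

end EulerProduct

section Zeta

open ENNReal Filter Topology

variable (F : Type*) [Field F] [NumberField F]

/-- The integral ideal with given exponents. -/
noncomputable def idealOfExponents {F : Type*} [Field F] [NumberField F]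
    (f : HeightOneSpectrum (𝓞 F) →₀ ℕ) : Ideal (𝓞 F) := f.prod fun 𝔭 n ↦ 𝔭.asIdeal ^ n

variable {F} in
theorem idealOfExponents_eq (f : HeightOneSpectrum (𝓞 F) →₀ ℕ) :
    idealOfExponents f = ((Finsupp.toMultiset f).map HeightOneSpectrum.asIdeal).prod := by
  rw [idealOfExponents, Finsupp.toMultiset_map, Finsupp.prod_toMultiset,
    Finsupp.prod_mapDomain_index (by simp) (by simp [pow_add])]

variable {F} in
theorem idealOfExponents_injective : Function.Injective (idealOfExponents (F := F)) := by
  intro f g h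
  rw [idealOfExponents_eq, idealOfExponents_eq] at h
  have key : ∀ f : HeightOneSpectrum (𝓞 F) →₀ ℕ,
      UniqueFactorizationMonoid.normalizedFactors
        ((Finsupp.toMultiset f).map HeightOneSpectrum.asIdeal).prod =
      (Finsupp.toMultiset f).map HeightOneSpectrum.asIdeal := fun f ↦ by
    refine UniqueFactorizationMonoid.normalizedFactors_prod_of_prime fun P hP ↦ ?_
    obtain ⟨v, -, rfl⟩ := Multiset.mem_map.1 hP
    exact v.prime
  have h2 := congrArg UniqueFactorizationMonoid.normalizedFactors h
  rw [key, key] at h2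
  have h3 := Multiset.map_injective (fun _ _ ↦ HeightOneSpectrum.ext) h2
  classical
  rw [← Finsupp.toMultiset_toFinsupp f, h3, Finsupp.toMultiset_toFinsupp]

variable {F} in
theorem exists_idealOfExponents_eq {I : Ideal (𝓞 F)} (hI : I ≠ 0) :
    ∃ f, idealOfExponents f = I := by
  classical
  let s : Multiset (HeightOneSpectrum (𝓞 F)) :=
    (UniqueFactorizationMonoid.normalizedFactors I).pmap (fun P h ↦ .ofPrime h)
      fun P hP ↦ UniqueFactorizationMonoid.prime_of_normalized_factor P hP
  have hs : s.map HeightOneSpectrum.asIdeal = UniqueFactorizationMonoid.normalizedFactors I := by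
    rw [Multiset.map_pmap]
    exact (Multiset.pmap_eq_map _ id _ _).trans (Multiset.map_id _)
  refine ⟨Multiset.toFinsupp s, ?_⟩
  rw [idealOfExponents_eq, Multiset.toFinsupp_toMultiset, hs]
  exact associated_iff_eq.1 (UniqueFactorizationMonoid.prod_normalizedFactors hI)

variable {F} in
theorem idealOfExponents_ne_zero (f : HeightOneSpectrum (𝓞 F) →₀ ℕ) : idealOfExponents f ≠ 0 :=
  Finset.prod_ne_zero_iff.2 fun 𝔭 _ ↦ pow_ne_zero _ 𝔭.ne_bot

/-- The weight `N𝔭 ^ (-s)`. -/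
noncomputable def normWeight (s : ℝ) (𝔭 : HeightOneSpectrum (𝓞 F)) : ℝ≥0∞ :=
  ENNReal.ofReal ((Ideal.absNorm 𝔭.asIdeal : ℝ) ^ (-s))

theorem normWeight_le {s : ℝ} (hs : 1 ≤ s) (𝔭 : HeightOneSpectrum (𝓞 F)) :
    normWeight F s 𝔭 ≤ 2⁻¹ := by
  have h : (2 : ℝ) ≤ Ideal.absNorm 𝔭.asIdeal := by
    exact_mod_cast HeightOneSpectrum.one_lt_absNorm 𝔭
  have h2 : (2⁻¹ : ℝ≥0∞) = ENNReal.ofReal 2⁻¹ := by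
    rw [ENNReal.ofReal_inv_of_pos two_pos, ENNReal.ofReal_ofNat]
  rw [normWeight, h2]
  refine ENNReal.ofReal_le_ofReal ?_
  rw [Real.rpow_neg (by positivity)]
  refine inv_anti₀ two_pos (h.trans ?_)
  exact Real.self_le_rpow_of_one_le (by linarith) hs

/-- The `n`-th term of the Dirichlet series of `dedekindZeta`, for a real exponent. -/
noncomputable def zetaTerm (s : ℝ) (n : ℕ) : ℝ :=
  if n = 0 then 0 else
    (Nat.card {I : Ideal (𝓞 F) // Ideal.absNorm I = n} : ℝ) * (n : ℝ) ^ (-s)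

theorem zetaTerm_nonneg (s : ℝ) (n : ℕ) : 0 ≤ zetaTerm F s n := by
  unfold zetaTerm
  split_ifs <;> positivity

/-- Unique factorization makes the exponents correspond to the nonzero ideals; grouping these by
norm gives the Dirichlet series. -/
theorem eulerSum_normWeight (s : ℝ) :
    eulerSum (normWeight F s) = ∑' n : ℕ, ENNReal.ofReal (zetaTerm F s n) := by
  have h1 : eulerSum (normWeight F s) =
      ∑' f, ENNReal.ofReal ((Ideal.absNorm (idealOfExponents (F := F) f) : ℝ) ^ (-s)) := by
    refine tsum_congr fun f ↦ ?_
    rw [idealOfExponents, Finsupp.prod, Finsupp.prod, map_prod, Nat.cast_prod,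
      ← Real.finsetProd_rpow _ _ fun _ _ ↦ Nat.cast_nonneg _,
      ENNReal.ofReal_prod_of_nonneg fun _ _ ↦ by positivity]
    refine Finset.prod_congr rfl fun 𝔭 _ ↦ ?_
    rw [normWeight, ← ENNReal.ofReal_pow (by positivity), map_pow, Nat.cast_pow,
      ← Real.rpow_natCast, ← Real.rpow_natCast, ← Real.rpow_mul (by positivity),
      ← Real.rpow_mul (by positivity), mul_comm]
  rw [h1, ← ENNReal.tsum_fiberwise _ fun f ↦ Ideal.absNorm (idealOfExponents (F := F) f)]
  refine tsum_congr fun n ↦ ?_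
  have h2 : ∀ b : ↑((fun f ↦ Ideal.absNorm (idealOfExponents (F := F) f)) ⁻¹' {n}),
      ENNReal.ofReal ((Ideal.absNorm (idealOfExponents (F := F) b) : ℝ) ^ (-s)) =
      ENNReal.ofReal ((n : ℝ) ^ (-s)) := fun b ↦ by
    rw [show Ideal.absNorm (idealOfExponents (F := F) b) = n from b.2]
  rw [tsum_congr h2, ENNReal.tsum_const, zetaTerm]
  split_ifs with hn
  · subst hn
    have : IsEmpty ↑((fun f ↦ Ideal.absNorm (idealOfExponents (F := F) f)) ⁻¹' {0}) :=
      ⟨fun f ↦ idealOfExponents_ne_zero f.1 (Ideal.absNorm_eq_zero_iff.1 f.2)⟩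
    simp [ENat.card_eq_zero_iff_empty _ |>.2 this]
  · have e : ↑((fun f ↦ Ideal.absNorm (idealOfExponents (F := F) f)) ⁻¹' {n}) ≃
        {I : Ideal (𝓞 F) // Ideal.absNorm I = n} :=
      Equiv.ofBijective (fun f ↦ ⟨idealOfExponents f.1, f.2⟩)
        ⟨fun f g h ↦ Subtype.ext (idealOfExponents_injective (congrArg Subtype.val h)), fun I ↦ by
          obtain ⟨f, hf⟩ := exists_idealOfExponents_eq (I := I.1) fun h ↦ hn (by
            rw [← I.2, h]; exact Ideal.absNorm_bot)
          exact ⟨⟨f, by rw [Set.mem_preimage, hf]; exact I.2⟩, Subtype.ext hf⟩⟩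
    have : Finite {I : Ideal (𝓞 F) // Ideal.absNorm I = n} :=
      Ideal.finite_setOfPred_absNorm_eq n
    rw [ENat.card_congr e, ENNReal.ofReal_mul (by positivity), ENat.card_eq_coe_natCard]
    simp

theorem dedekindZeta_ofReal (s : ℝ) : dedekindZeta F s = ((∑' n, zetaTerm F s n : ℝ) : ℂ) := by
  rw [dedekindZeta, LSeries, Complex.ofReal_tsum]
  refine tsum_congr fun n ↦ ?_
  rw [LSeries.term_def, zetaTerm]
  split_ifs with hn
  · simp
  · rw [Complex.ofReal_mul, Complex.ofReal_cpow (by positivity), Complex.ofReal_neg,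
      Complex.cpow_neg, div_eq_mul_inv]
    simp

theorem tendsto_norm_dedekindZeta :
    Tendsto (fun s : ℝ ↦ (s - 1) * ‖dedekindZeta F s‖) (𝓝[>] 1) (𝓝 (dedekindZeta_residue F)) := by
  have h := (tendsto_sub_one_mul_dedekindZeta_nhdsGT F).norm
  rw [Complex.norm_real, Real.norm_of_nonneg (dedekindZeta_residue_pos F).le] at h
  refine h.congr' ?_
  filter_upwards [self_mem_nhdsWithin] with s hs
  have : (s : ℂ) - 1 = ((s - 1 : ℝ) : ℂ) := by push_cast; rfl
  rw [norm_mul, this, Complex.norm_real, Real.norm_of_nonneg (sub_nonneg.2 (le_of_lt hs))]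

theorem eventually_eulerSum_normWeight_eq : ∀ᶠ s : ℝ in 𝓝[>] 1,
    eulerSum (normWeight F s) = ENNReal.ofReal ‖dedekindZeta F s‖ := by
  filter_upwards [(tendsto_norm_dedekindZeta F).eventually_ne (dedekindZeta_residue_ne_zero F)]
    with s hs
  -- Near $1$ the nonzero residue forces $\zeta_F(s)\neq 0$. A divergent series would have the
  -- default sum $0$, so convergence comes for free.
  have hs' : Summable (zetaTerm F s) := by
    by_contra h
    refine hs ?_
    rw [dedekindZeta_ofReal, tsum_eq_zero_of_not_summable h]
    simp
  rw [eulerSum_normWeight, dedekindZeta_ofReal, Complex.norm_real, Real.norm_of_nonneg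
    (tsum_nonneg (zetaTerm_nonneg F s)), ENNReal.ofReal_tsum_of_nonneg (zetaTerm_nonneg F s) hs']

variable {F} in
/-- A number field `L` cannot have, for almost all the places of `F`, two places of at most the
same norm. -/
theorem not_injective_of_absNorm_le {L : Type*} [Field L] [NumberField L]
    {p : HeightOneSpectrum (𝓞 F) → Prop} (hp : {𝔭 | ¬ p 𝔭}.Finite)
    (e : {𝔭 // p 𝔭} ⊕ {𝔭 // p 𝔭} → HeightOneSpectrum (𝓞 L))
    (he : ∀ 𝔭, Ideal.absNorm (e (.inl 𝔭)).asIdeal ≤ Ideal.absNorm 𝔭.1.asIdeal)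
    (he' : ∀ 𝔭, Ideal.absNorm (e (.inr 𝔭)).asIdeal ≤ Ideal.absNorm 𝔭.1.asIdeal) :
    ¬ Function.Injective e := by
  classical
  intro hinj
  have : Finite {𝔭 // ¬ p 𝔭} := hp.to_subtype
  set c := Nat.card {𝔭 // ¬ p 𝔭}
  -- Each of the `c` exceptional Euler factors is at most $2$. The remaining product, squared, is
  -- dominated by a partial Euler product of $L$.
  have key : ∀ s : ℝ, 1 ≤ s → eulerSum (normWeight F s) ^ 2 ≤
      (2 ^ c) ^ 2 * eulerSum (normWeight L s) := by
    intro s hs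
    let w : {𝔭 // p 𝔭} → ℝ≥0∞ := fun 𝔭 ↦ normWeight F s 𝔭
    have h1 : eulerSum (normWeight F s) ≤ 2 ^ c * eulerSum w := by
      rw [← eulerSum_comp_equiv (Equiv.sumCompl p), eulerSum_sum, mul_comm]
      exact mul_le_mul_left (eulerSum_le_two_pow _ fun 𝔭 ↦ normWeight_le F hs _) _
    have hle : ∀ (𝔓 : HeightOneSpectrum (𝓞 L)) (𝔭 : HeightOneSpectrum (𝓞 F)),
        Ideal.absNorm 𝔓.asIdeal ≤ Ideal.absNorm 𝔭.asIdeal →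
        normWeight F s 𝔭 ≤ normWeight L s 𝔓 := by
      intro 𝔓 𝔭 h
      have hpos := HeightOneSpectrum.one_lt_absNorm 𝔓
      refine ENNReal.ofReal_le_ofReal (Real.rpow_le_rpow_of_nonpos ?_ ?_ (by linarith))
      · exact_mod_cast (zero_lt_one.trans hpos)
      · exact_mod_cast h
    have h2 : eulerSum w * eulerSum w ≤ eulerSum (normWeight L s) := by
      refine le_trans ?_ (eulerSum_comp_le ⟨e, hinj⟩ _)
      rw [eulerSum_sum]
      exact mul_le_mul' (eulerSum_mono fun 𝔭 ↦ hle _ _ (he 𝔭))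
        (eulerSum_mono fun 𝔭 ↦ hle _ _ (he' 𝔭))
    calc _ ≤ (2 ^ c * eulerSum w) ^ 2 := pow_le_pow_left' h1 2
      _ = (2 ^ c) ^ 2 * (eulerSum w * eulerSum w) := by ring
      _ ≤ _ := mul_le_mul_right h2 _
  have hlim : Tendsto (fun s : ℝ ↦ ((s - 1) * ‖dedekindZeta F s‖) ^ 2) (𝓝[>] 1)
      (𝓝 (dedekindZeta_residue F ^ 2)) := (tendsto_norm_dedekindZeta F).pow 2
  have h0 : Tendsto (fun s : ℝ ↦ s - 1) (𝓝[>] 1) (𝓝 0) := by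
    have : Tendsto (fun s : ℝ ↦ s - 1) (𝓝 1) (𝓝 (1 - 1)) := tendsto_id.sub_const 1
    rw [sub_self] at this
    exact this.mono_left nhdsWithin_le_nhds
  have hlim2 : Tendsto (fun s : ℝ ↦ (2 ^ c) ^ 2 * ((s - 1) * ((s - 1) * ‖dedekindZeta L s‖)))
      (𝓝[>] 1) (𝓝 0) := by
    simpa using (h0.mul (tendsto_norm_dedekindZeta L)).const_mul ((2 ^ c) ^ 2)
  -- After multiplication by $(s-1)^2$, the left side tends to the square of a positive residue,
  -- whereas the right side, with a simple pole only, tends to $0$.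
  have hle := le_of_tendsto_of_tendsto hlim hlim2 ?_
  · have := dedekindZeta_residue_pos F
    nlinarith
  · filter_upwards [eventually_eulerSum_normWeight_eq F, eventually_eulerSum_normWeight_eq L,
      self_mem_nhdsWithin] with s hF hL hs
    have h := key s (le_of_lt hs)
    rw [hF, hL, ← ENNReal.ofReal_pow (norm_nonneg _)] at h
    have h2 : ((2 : ℝ≥0∞) ^ c) ^ 2 = ENNReal.ofReal ((2 ^ c) ^ 2) := by
      rw [ENNReal.ofReal_pow (by positivity), ENNReal.ofReal_pow (by positivity)]
      simp
    rw [h2, ← ENNReal.ofReal_mul (by positivity),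
      ENNReal.ofReal_le_ofReal_iff (by positivity)] at h
    have h3 := mul_le_mul_of_nonneg_left h (sq_nonneg (s - 1))
    calc _ = (s - 1) ^ 2 * ‖dedekindZeta F s‖ ^ 2 := by ring
      _ ≤ _ := h3
      _ = _ := by ring

end Zeta

end LogClass

namespace LogClass

/-! ### Cyclotomic extensions in which almost all places split -/

section SplitPlaces

open Module
open scoped Pointwise

variable {F L : Type*} [Field F] [NumberField F] [Field L] [NumberField L] [Algebra F L]

omit [NumberField L] in
theorem natCard_quotient_under (𝔓 : HeightOneSpectrum (𝓞 L)) :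
    Nat.card (𝓞 F ⧸ 𝔓.asIdeal.under (𝓞 F)) = Ideal.absNorm (𝔓.under (𝓞 F)).asIdeal := by
  rw [Ideal.absNorm_apply, Submodule.cardQuot_apply]; rfl

omit [NumberField L] in
theorem exists_under_eq (𝔭 : HeightOneSpectrum (𝓞 F)) :
    ∃ 𝔓 : HeightOneSpectrum (𝓞 L), 𝔓.under (𝓞 F) = 𝔭 := by
  have := 𝔭.isMaximal
  obtain ⟨P, hP, h⟩ := Ideal.exists_maximal_ideal_liesOver_of_isIntegral (S := 𝓞 L) 𝔭.asIdeal
  have hP0 : P ≠ ⊥ := Ideal.ne_bot_of_liesOver_of_ne_bot 𝔭.ne_bot P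
  exact ⟨⟨P, hP.isPrime, hP0⟩, HeightOneSpectrum.ext h.over.symm⟩

/-- All elements of the residue field are roots of $X^q-X$. -/
theorem absNorm_le_of_pow_sub_mem (𝔓 : HeightOneSpectrum (𝓞 L)) {q : ℕ} (hq : 1 < q)
    (h : ∀ x : 𝓞 L, x ^ q - x ∈ 𝔓.asIdeal) : Ideal.absNorm 𝔓.asIdeal ≤ q := by
  classical
  have hmax := 𝔓.isMaximal
  let _ := Ideal.Quotient.field 𝔓.asIdeal
  have hfin : Finite (𝓞 L ⧸ 𝔓.asIdeal) := Ideal.finiteQuotientOfFreeOfNeBot _ 𝔓.ne_bot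
  have := Fintype.ofFinite (𝓞 L ⧸ 𝔓.asIdeal)
  rw [Ideal.absNorm_apply, Submodule.cardQuot_apply]
  have hne := FiniteField.X_pow_card_sub_X_ne_zero (𝓞 L ⧸ 𝔓.asIdeal) hq
  have hdeg := FiniteField.X_pow_card_sub_X_natDegree_eq (𝓞 L ⧸ 𝔓.asIdeal) hq
  have hsub : (Finset.univ : Finset (𝓞 L ⧸ 𝔓.asIdeal)) ⊆
      (Polynomial.X ^ q - Polynomial.X : Polynomial (𝓞 L ⧸ 𝔓.asIdeal)).roots.toFinset := by
    intro x _
    obtain ⟨x, rfl⟩ := Ideal.Quotient.mk_surjective x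
    rw [Multiset.mem_toFinset, Polynomial.mem_roots hne, Polynomial.IsRoot.def]
    simp only [Polynomial.eval_sub, Polynomial.eval_pow, Polynomial.eval_X]
    rw [← map_pow, ← map_sub, Ideal.Quotient.eq_zero_iff_mem]
    exact h x
  have h1 := Finset.card_le_card hsub
  rw [Finset.card_univ] at h1
  calc _ = Fintype.card (𝓞 L ⧸ 𝔓.asIdeal) := Nat.card_eq_fintype_card
    _ ≤ _ := h1
    _ ≤ _ := Multiset.toFinset_card_le _
    _ ≤ _ := Polynomial.card_roots' _
    _ = q := hdeg

theorem exists_sub_algebraMap_mem {𝔓 : HeightOneSpectrum (𝓞 L)}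
    (h : Ideal.absNorm 𝔓.asIdeal ≤ Ideal.absNorm (𝔓.under (𝓞 F)).asIdeal) (x : 𝓞 L) :
    ∃ a : 𝓞 F, x - algebraMap (𝓞 F) (𝓞 L) a ∈ 𝔓.asIdeal := by
  have hfin : Finite (𝓞 L ⧸ 𝔓.asIdeal) := Ideal.finiteQuotientOfFreeOfNeBot _ 𝔓.ne_bot
  rw [← natCard_quotient_under, Ideal.absNorm_apply, Submodule.cardQuot_apply] at h
  have hbij := Function.Injective.bijective_of_nat_card_le
    (Ideal.algebraMap_quotient_injective (R := 𝓞 F) (I := 𝔓.asIdeal)) h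
  obtain ⟨y, hy⟩ := hbij.2 (Ideal.Quotient.mk _ x)
  obtain ⟨a, rfl⟩ := Ideal.Quotient.mk_surjective y
  exact ⟨a, Ideal.Quotient.eq.1 hy.symm⟩

variable {m : ℕ} [NeZero m] [IsCyclotomicExtension {m} F L] [IsGalois F L]

/-- A Frobenius raises $\zeta_m$ to the power $N\mathfrak p\equiv 1$ modulo $m$, and $\zeta_m$
generates $L$. -/
theorem eq_one_of_isArithFrobAt {𝔓 : HeightOneSpectrum (𝓞 L)} (hm : (m : 𝓞 L) ∉ 𝔓.asIdeal)
    (hcong : Ideal.absNorm (𝔓.under (𝓞 F)).asIdeal ≡ 1 [MOD m]) {σ : Gal(L/F)}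
    (hσ : IsArithFrobAt (𝓞 F) σ 𝔓.asIdeal) : σ = 1 := by
  have hζ := IsCyclotomicExtension.zeta_spec m F L
  have h1 := hσ.apply_of_pow_eq_one (ζ := hζ.toInteger) (m := m)
    hζ.toInteger_isPrimitiveRoot.pow_eq_one hm
  rw [hζ.toInteger_isPrimitiveRoot.eq_orderOf] at hcong
  rw [natCard_quotient_under, ← pow_mod_orderOf, hcong, pow_mod_orderOf, pow_one] at h1
  have h2 : σ (IsCyclotomicExtension.zeta m F L) = IsCyclotomicExtension.zeta m F L :=
    congrArg (algebraMap (𝓞 L) L) h1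
  have h3 : (σ : L →ₐ[F] L) = AlgHom.id F L := by
    refine AlgHom.ext_of_adjoin_eq_top
      (IsCyclotomicExtension.adjoin_primitive_root_eq_top hζ) ?_
    rintro _ rfl
    exact h2
  ext x
  exact DFunLike.congr_fun h3 x

/-- Trivial Frobenius elements mean residue degree $1$. If $\sigma\neq 1$, the primes $\mathfrak P$
and $\sigma\mathfrak P$ above each $\mathfrak p\nmid m$ are distinct and have norm at most
$N\mathfrak p$, which the comparison of zeta poles forbids. -/
theorem subsingleton_of_forall_absNorm_modEq_one
    (h : ∀ 𝔭 : HeightOneSpectrum (𝓞 F), (m : 𝓞 F) ∉ 𝔭.asIdeal →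
      Ideal.absNorm 𝔭.asIdeal ≡ 1 [MOD m]) : Subsingleton Gal(L/F) := by
  refine subsingleton_of_forall_eq 1 fun σ ↦ by_contra fun hσ ↦ ?_
  choose P hP using exists_under_eq (F := F) (L := L)
  let p : HeightOneSpectrum (𝓞 F) → Prop := fun 𝔭 ↦ (m : 𝓞 F) ∉ 𝔭.asIdeal
  have hp : {𝔭 | ¬ p 𝔭}.Finite := by
    have := Ideal.finite_factors (I := Ideal.span {(m : 𝓞 F)}) (by
      simpa using NeZero.ne m)
    refine this.subset fun 𝔭 h𝔭 ↦ ?_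
    simpa [p, Ideal.dvd_span_singleton] using h𝔭
  have hmem : ∀ 𝔓 : HeightOneSpectrum (𝓞 L), (m : 𝓞 L) ∈ 𝔓.asIdeal →
      (m : 𝓞 F) ∈ (𝔓.under (𝓞 F)).asIdeal := fun 𝔓 h ↦ by
    change algebraMap (𝓞 F) (𝓞 L) m ∈ 𝔓.asIdeal
    simpa using h
  have hfrob : ∀ 𝔓 : HeightOneSpectrum (𝓞 L), p (𝔓.under (𝓞 F)) → ∀ τ : Gal(L/F),
      IsArithFrobAt (𝓞 F) τ 𝔓.asIdeal → τ = 1 := fun 𝔓 h𝔓 τ hτ ↦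
    eq_one_of_isArithFrobAt (m := m) (fun h ↦ h𝔓 (hmem 𝔓 h)) (h _ h𝔓) hτ
  have hone : ∀ 𝔓 : HeightOneSpectrum (𝓞 L), p (𝔓.under (𝓞 F)) →
      IsArithFrobAt (𝓞 F) (1 : Gal(L/F)) 𝔓.asIdeal := fun 𝔓 h𝔓 ↦ by
    have := 𝔓.isPrime
    have : Finite (𝓞 L ⧸ 𝔓.asIdeal) := Ideal.finiteQuotientOfFreeOfNeBot _ 𝔓.ne_bot
    obtain ⟨τ, hτ⟩ := IsArithFrobAt.exists_of_isInvariant (𝓞 F) Gal(L/F) 𝔓.asIdeal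
    rwa [hfrob 𝔓 h𝔓 τ hτ] at hτ
  have hpow : ∀ 𝔓 : HeightOneSpectrum (𝓞 L), p (𝔓.under (𝓞 F)) → ∀ x : 𝓞 L,
      x ^ Ideal.absNorm (𝔓.under (𝓞 F)).asIdeal - x ∈ 𝔓.asIdeal := fun 𝔓 h𝔓 x ↦ by
    have := hone 𝔓 h𝔓 x
    rw [natCard_quotient_under, ← neg_mem_iff, neg_sub] at this
    simpa using this
  let s : HeightOneSpectrum (𝓞 L) → HeightOneSpectrum (𝓞 L) := fun 𝔓 ↦
    ⟨σ • 𝔓.asIdeal, inferInstance, by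
      rw [← Ideal.smul_bot σ]
      exact fun h ↦ 𝔓.ne_bot (smul_left_cancel σ h)⟩
  have hs : ∀ 𝔓, (s 𝔓).under (𝓞 F) = 𝔓.under (𝓞 F) := fun 𝔓 ↦
    HeightOneSpectrum.ext (Ideal.under_smul (𝓞 F) 𝔓.asIdeal σ)
  have hle : ∀ 𝔓 : HeightOneSpectrum (𝓞 L), p (𝔓.under (𝓞 F)) →
      Ideal.absNorm 𝔓.asIdeal ≤ Ideal.absNorm (𝔓.under (𝓞 F)).asIdeal := fun 𝔓 h𝔓 ↦
    absNorm_le_of_pow_sub_mem 𝔓 (HeightOneSpectrum.one_lt_absNorm _) (hpow 𝔓 h𝔓)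
  refine not_injective_of_absNorm_le hp
    (Sum.elim (fun 𝔭 ↦ P 𝔭.1) (fun 𝔭 ↦ s (P 𝔭.1))) (fun 𝔭 ↦ ?_) (fun 𝔭 ↦ ?_) ?_
  · have := hle (P 𝔭.1) (by rw [hP]; exact 𝔭.2)
    rwa [hP] at this
  · have := hle (s (P 𝔭.1)) (by rw [hs, hP]; exact 𝔭.2)
    rwa [hs, hP] at this
  · have hinj : ∀ 𝔭 𝔮, P 𝔭 = P 𝔮 → 𝔭 = 𝔮 := fun 𝔭 𝔮 h ↦ by rw [← hP 𝔭, h, hP]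
    -- If $\sigma$ stabilized the prime, it would act trivially on the residue field, which comes
    -- from $F$. It would then satisfy the Frobenius congruence and be $1$.
    have hne : ∀ 𝔭 : {𝔭 // p 𝔭}, s (P 𝔭) ≠ P 𝔭 := fun 𝔭 h𝔭 ↦ by
      have hp' : p ((P 𝔭).under (𝓞 F)) := by rw [hP]; exact 𝔭.2
      refine hσ (hfrob (P 𝔭) hp' σ fun x ↦ ?_)
      obtain ⟨a, ha⟩ := exists_sub_algebraMap_mem (hle (P 𝔭) hp') x
      have h1 : σ • (x - algebraMap (𝓞 F) (𝓞 L) a) ∈ (P 𝔭).asIdeal := by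
        rw [← congrArg HeightOneSpectrum.asIdeal h𝔭]
        exact Ideal.smul_mem_pointwise_smul σ _ _ ha
      rw [smul_sub, smul_algebraMap] at h1
      have h2 := hpow (P 𝔭) hp' x
      rw [natCard_quotient_under]
      have h3 := sub_mem (sub_mem h1 ha) h2
      simpa using h3
    rintro (𝔭 | 𝔭) (𝔮 | 𝔮) h
    · exact congrArg _ (Subtype.ext (hinj _ _ h))
    · have h' : P 𝔭.1 = s (P 𝔮.1) := h
      have : 𝔭 = 𝔮 := Subtype.ext (by rw [← hP 𝔭, h', hs, hP])
      exact (hne 𝔮 (this ▸ h').symm).elim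
    · have h' : s (P 𝔭.1) = P 𝔮.1 := h
      have : 𝔭 = 𝔮 := Subtype.ext (by rw [← hP 𝔮, ← h', hs, hP])
      exact (hne 𝔭 (this ▸ h')).elim
    · have h' : s (P 𝔭.1) = s (P 𝔮.1) := h
      exact congrArg _ (Subtype.ext (by rw [← hP 𝔭, ← hs, h', hs, hP]))

/-- If almost all places of `F` have norm congruent to `1` modulo `m`, then `F` contains the
`m`-th roots of unity. -/
theorem exists_isPrimitiveRoot (m : ℕ) [NeZero m]
    (h : ∀ 𝔭 : HeightOneSpectrum (𝓞 F), (m : 𝓞 F) ∉ 𝔭.asIdeal →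
      Ideal.absNorm 𝔭.asIdeal ≡ 1 [MOD m]) : ∃ ζ : F, IsPrimitiveRoot ζ m := by
  have : NumberField (CyclotomicField m F) := IsCyclotomicExtension.numberField {m} F _
  have := IsCyclotomicExtension.isGalois {m} F (CyclotomicField m F)
  have := subsingleton_of_forall_absNorm_modEq_one (L := CyclotomicField m F) h
  have hζ := IsCyclotomicExtension.zeta_spec m F (CyclotomicField m F)
  obtain ⟨ζ, h1⟩ := (IsGalois.mem_range_algebraMap_iff_fixed (F := F) (E := CyclotomicField m F)
    (IsCyclotomicExtension.zeta m F (CyclotomicField m F))).2 fun σ ↦ by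
      rw [Subsingleton.elim σ 1]; rfl
  exact ⟨ζ, (h1 ▸ hζ).of_map_of_injective (algebraMap F (CyclotomicField m F)).injective⟩

end SplitPlaces

end LogClass

namespace LogClass

/-! ### From divisible degrees to roots of unity -/

section RootsOfUnityOfDegrees

variable {ℓ : ℕ} [Fact ℓ.Prime] {F : Type*} [Field F] [NumberField F]

theorem pow_dvd_absNorm_pow_sub_one (hℓ : ℓ ≠ 2) {N : ℕ} {𝔭 : HeightOneSpectrum (𝓞 F)}
    (h𝔭 : (ℓ : 𝓞 F) ∉ 𝔭.asIdeal) (h : ‖placeDeg ℓ 𝔭‖ ≤ (ℓ : ℝ) ^ (-(N : ℤ))) :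
    (ℓ : ℤ) ^ N ∣ (Ideal.absNorm 𝔭.asIdeal : ℤ) ^ (ℓ - 1) - 1 := by
  have h1 : ‖((Ideal.absNorm 𝔭.asIdeal : ℕ) : ℚ_[ℓ])‖ = 1 :=
    Padic.norm_natCast_eq_one_iff.2 (coprime_absNorm h𝔭)
  rw [placeDeg_of_notMem h𝔭, norm_iwasawaLog hℓ h1] at h
  have := (Padic.norm_int_le_pow_iff_dvd (p := ℓ)
    ((Ideal.absNorm 𝔭.asIdeal : ℤ) ^ (ℓ - 1) - 1) N).1 (by exact_mod_cast h)
  exact_mod_cast this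

/-- The cofactor $1+a+\dots+a^{\ell-2}$ is congruent to $\ell-1$ modulo $\ell$, hence prime to
$\ell$. -/
theorem modEq_one_of_pow_dvd {a : ℤ} {N : ℕ} (h1 : (ℓ : ℤ) ∣ a - 1)
    (h : (ℓ : ℤ) ^ N ∣ a ^ (ℓ - 1) - 1) : (ℓ : ℤ) ^ N ∣ a - 1 := by
  have hp : ℓ.Prime := Fact.out
  rw [← geom_sum_mul] at h
  refine IsCoprime.dvd_of_dvd_mul_left (IsCoprime.pow_left ?_) h
  rw [Prime.coprime_iff_not_dvd (Nat.prime_iff_prime_int.1 hp)]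
  intro h2
  have h3 : (ℓ : ℤ) ∣ ∑ i ∈ Finset.range (ℓ - 1), (a ^ i - 1) :=
    Finset.dvd_sum fun i _ ↦ h1.trans (sub_one_dvd_pow_sub_one a i)
  rw [Finset.sum_sub_distrib] at h3
  have h4 := dvd_sub h2 h3
  rw [sub_sub_cancel] at h4
  simp only [Finset.sum_const, Finset.card_range, nsmul_eq_mul, mul_one] at h4
  have h5 := Nat.le_of_dvd (Nat.sub_pos_of_lt hp.one_lt) (Int.natCast_dvd_natCast.1 h4)
  have := hp.pos
  omega

/-- The image of $\zeta$ keeps order $\ell$ in the multiplicative group of the residue field. -/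
theorem dvd_absNorm_sub_one {ζ : F} (hζ : IsPrimitiveRoot ζ ℓ) {𝔭 : HeightOneSpectrum (𝓞 F)}
    (h𝔭 : (ℓ : 𝓞 F) ∉ 𝔭.asIdeal) : (ℓ : ℤ) ∣ (Ideal.absNorm 𝔭.asIdeal : ℤ) - 1 := by
  have : NeZero ℓ := ⟨(Fact.out : ℓ.Prime).ne_zero⟩
  have hmax := 𝔭.isMaximal
  let _ := Ideal.Quotient.field 𝔭.asIdeal
  have h1 := hζ.toInteger_isPrimitiveRoot.idealQuotient_mk (I := 𝔭.asIdeal)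
    (HeightOneSpectrum.one_lt_absNorm 𝔭).ne' (coprime_absNorm h𝔭).symm
  have hfin : Finite (𝓞 F ⧸ 𝔭.asIdeal) := Ideal.finiteQuotientOfFreeOfNeBot _ 𝔭.ne_bot
  obtain ⟨u, hu⟩ := h1.isUnit this.ne
  have h2 : orderOf u = ℓ := by
    rw [← orderOf_units, hu]; exact h1.eq_orderOf.symm
  have h3 := orderOf_dvd_natCard u
  rw [h2, Nat.card_units] at h3
  have h4 : Nat.card (𝓞 F ⧸ 𝔭.asIdeal) = Ideal.absNorm 𝔭.asIdeal := by
    rw [Ideal.absNorm_apply, Submodule.cardQuot_apply]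
  rw [h4] at h3
  have := HeightOneSpectrum.one_lt_absNorm 𝔭
  rw [← Int.natCast_dvd_natCast, Nat.cast_sub this.le] at h3
  exact_mod_cast h3

/-- If the degrees of the places prime to `ℓ` are all divisible by `ℓ ^ N`, then `F(ζ_ℓ)` contains
the `ℓ ^ N`-th roots of unity. -/
theorem exists_isPrimitiveRoot_of_norm_placeDeg_le (hℓ : ℓ ≠ 2) {N : ℕ}
    (h : ∀ 𝔭 : HeightOneSpectrum (𝓞 F), (ℓ : 𝓞 F) ∉ 𝔭.asIdeal →
      ‖placeDeg ℓ 𝔭‖ ≤ (ℓ : ℝ) ^ (-(N : ℤ)))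
    {L : Type*} [Field L] [NumberField L] [Algebra F L] {ζ : L} (hζ : IsPrimitiveRoot ζ ℓ) :
    ∃ ξ : L, IsPrimitiveRoot ξ (ℓ ^ N) := by
  have : NeZero ℓ := ⟨(Fact.out : ℓ.Prime).ne_zero⟩
  have : NeZero (ℓ ^ N) := ⟨pow_ne_zero _ this.ne⟩
  refine exists_isPrimitiveRoot (ℓ ^ N) fun 𝔓 h𝔓 ↦ ?_
  -- For $N=0$ the modulus is $1$ and says nothing about places above $\ell$, but the congruence is
  -- trivial.
  rcases N.eq_zero_or_pos with rfl | hN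
  · rw [pow_zero]; exact Nat.modEq_one
  have hℓ𝔓 : (ℓ : 𝓞 L) ∉ 𝔓.asIdeal := fun h ↦ h𝔓 (by
    rw [Nat.cast_pow]; exact Ideal.pow_mem_of_mem _ h _ hN)
  have hℓ𝔭 : (ℓ : 𝓞 F) ∉ (𝔓.under (𝓞 F)).asIdeal := by rwa [natCast_mem_under_iff]
  have h1 := pow_dvd_absNorm_pow_sub_one hℓ hℓ𝔭 (h _ hℓ𝔭)
  have h2 : (ℓ : ℤ) ^ N ∣ (Ideal.absNorm 𝔓.asIdeal : ℤ) ^ (ℓ - 1) - 1 := by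
    rw [← absNorm_pow_inertiaDeg_under (F := F) 𝔓, Nat.cast_pow, ← pow_mul, mul_comm, pow_mul]
    exact h1.trans (sub_one_dvd_pow_sub_one _ _)
  have h3 := modEq_one_of_pow_dvd (dvd_absNorm_sub_one hζ hℓ𝔓) h2
  refine ((Nat.modEq_iff_dvd).2 ?_).symm
  exact_mod_cast h3

/-- Transfers the root of unity from an abstract $F(\zeta_\ell)$ to $E(z)$: every embedding sends
$\zeta_\ell$ to a power of $z$. -/
theorem exists_mem_adjoin_isPrimitiveRoot (hℓ : ℓ ≠ 2) {N : ℕ}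
    (h : ∀ 𝔭 : HeightOneSpectrum (𝓞 F), (ℓ : 𝓞 F) ∉ 𝔭.asIdeal →
      ‖placeDeg ℓ 𝔭‖ ≤ (ℓ : ℝ) ^ (-(N : ℤ)))
    {E Ω : Type*} [Field E] [Algebra F E] [Field Ω] [IsAlgClosed Ω] [Algebra E Ω] [Algebra F Ω]
    [IsScalarTower F E Ω] {z : Ω} (hz : IsPrimitiveRoot z ℓ) :
    ∃ ξ ∈ E⟮z⟯, IsPrimitiveRoot ξ (ℓ ^ N) := by
  have : NeZero ℓ := ⟨(Fact.out : ℓ.Prime).ne_zero⟩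
  have : NumberField (CyclotomicField ℓ F) := IsCyclotomicExtension.numberField {ℓ} F _
  have hζ := IsCyclotomicExtension.zeta_spec ℓ F (CyclotomicField ℓ F)
  obtain ⟨ξ, hξ⟩ := exists_isPrimitiveRoot_of_norm_placeDeg_le hℓ h hζ
  have : FiniteDimensional F (CyclotomicField ℓ F) :=
    IsCyclotomicExtension.finiteDimensional {ℓ} _ _
  let ψ : CyclotomicField ℓ F →ₐ[F] Ω := IsAlgClosed.lift
  refine ⟨ψ ξ, ?_, hξ.map_of_injective ψ.injective⟩
  clear hξ
  have hmem : ξ ∈ Algebra.adjoin F {IsCyclotomicExtension.zeta ℓ F (CyclotomicField ℓ F)} := by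
    rw [IsCyclotomicExtension.adjoin_primitive_root_eq_top hζ]; trivial
  induction hmem using Algebra.adjoin_induction with
  | mem x hx =>
    rw [Set.mem_singleton_iff.1 hx]
    obtain ⟨i, -, h⟩ := hz.eq_pow_of_pow_eq_one (hζ.map_of_injective ψ.injective).pow_eq_one
    exact h ▸ pow_mem (mem_adjoin_simple_self E z) i
  | algebraMap x =>
    rw [ψ.commutes, IsScalarTower.algebraMap_apply F E Ω]
    exact E⟮z⟯.algebraMap_mem _
  | add _ _ _ _ h1 h2 => rw [map_add]; exact add_mem h1 h2
  | mul _ _ _ _ h1 h2 => rw [map_mul]; exact mul_mem h1 h2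

end RootsOfUnityOfDegrees

/-! ### $\mathbb{Z}_\ell$-extensions that acquire all $\ell$-power roots of unity -/

section ZlExtension

variable (ℓ : ℕ) [Fact ℓ.Prime] (K Kinf : Type*) [Field K] [Field Kinf] [Algebra K Kinf]
  [IsZlExtension ℓ K Kinf]

variable {K Kinf} in
include ℓ in
theorem eq_one_of_isOfFinOrder {σ : Gal(Kinf/K)} (hσ : IsOfFinOrder σ) : σ = 1 := by
  obtain ⟨e⟩ := IsZlExtension.nonempty_equiv (ℓ := ℓ) (K := K) (Kinf := Kinf)
  obtain ⟨n, hn, h⟩ := isOfFinOrder_iff_pow_eq_one.1 hσ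
  have h2 : n • (e σ).toAdd = 0 := by
    rw [← toAdd_pow, ← map_pow, h, map_one, toAdd_one]
  rw [smul_eq_zero] at h2
  have h3 : e σ = 1 := Multiplicative.toAdd.injective (h2.resolve_left hn.ne')
  exact e.injective (h3.trans (map_one e).symm)

-- Let $a\neq 0$ correspond to $\sigma$ and let $n=v(a)$. The stabilizer of $x$ is closed, so it
-- contains the closed subgroup $a\mathbb{Z}_\ell=\ell^n\mathbb{Z}_\ell$, that is $\Gamma^{\ell^n}$.
variable {K Kinf} in
theorem exists_mem_layer_of_fixed {σ : Gal(Kinf/K)} (hσ : σ ≠ 1) :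
    ∃ n, ∀ x : Kinf, σ x = x → x ∈ layer ℓ K Kinf n := by
  have := IsZlExtension.isGalois ℓ (K := K) (Kinf := Kinf)
  obtain ⟨e⟩ := IsZlExtension.nonempty_equiv (ℓ := ℓ) (K := K) (Kinf := Kinf)
  set a : ℤ_[ℓ] := (e σ).toAdd with ha
  have ha0 : a ≠ 0 := fun h ↦ hσ (e.injective (by
    rw [map_one]; exact Multiplicative.toAdd.injective h))
  refine ⟨a.valuation, fun x hx ↦ ?_⟩
  have hclosed : IsClosed {y : ℤ_[ℓ] | e.symm (Multiplicative.ofAdd (y * a)) x = x} := by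
    have h1 : IsClosed (MulAction.stabilizer Gal(Kinf/K) x : Set Gal(Kinf/K)) :=
      Subgroup.isClosed_of_isOpen _ (stabilizer_isOpen_of_isIntegral x)
    refine h1.preimage (e.symm.continuous_toFun.comp (continuous_ofAdd.comp ?_))
    fun_prop
  have hall : ∀ y : ℤ_[ℓ], e.symm (Multiplicative.ofAdd (y * a)) x = x := by
    refine fun y ↦ PadicInt.denseRange_natCast.induction_on y hclosed fun n ↦ ?_
    rw [← nsmul_eq_mul, ofAdd_nsmul, map_pow, ha, ofAdd_toAdd]
    have h2 : e.symm (e σ) = σ := e.symm_apply_apply σ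
    rw [h2]
    induction n with
    | zero => rfl
    | succ n ih => rw [pow_succ, AlgEquiv.mul_apply, hx, ih]
  rw [layer, IntermediateField.mem_fixedField_iff]
  intro τ hτ
  change τ • x = x
  rw [← MulAction.mem_stabilizer_iff]
  refine (Subgroup.closure_le _).2 ?_ hτ
  rintro _ ⟨γ, rfl⟩
  have h2 := hall ((e γ).toAdd * ((PadicInt.unitCoeff ha0)⁻¹ : ℤ_[ℓ]ˣ))
  have h3 : (e γ).toAdd * ((PadicInt.unitCoeff ha0)⁻¹ : ℤ_[ℓ]ˣ) * a =
      (ℓ ^ a.valuation) • (e γ).toAdd := by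
    have h4 : ((PadicInt.unitCoeff ha0)⁻¹ : ℤ_[ℓ]ˣ) * a = (ℓ : ℤ_[ℓ]) ^ a.valuation :=
      (Units.inv_mul_eq_iff_eq_mul _).2 (PadicInt.unitCoeff_spec ha0)
    rw [mul_assoc, h4, nsmul_eq_mul, mul_comm, Nat.cast_pow]
  rw [h3, ofAdd_nsmul, map_pow, ofAdd_toAdd] at h2
  have h4 : e.symm (e γ) = γ := e.symm_apply_apply γ
  rwa [h4] at h2

variable {K Kinf}

omit [Field Kinf] [Algebra K Kinf] [IsZlExtension ℓ K Kinf] in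
theorem exists_forall_not_isPrimitiveRoot [NumberField K] {Ω : Type*} [Field Ω] [Algebra K Ω]
    (B : IntermediateField K Ω) [FiniteDimensional K B] :
    ∃ N, ∀ ξ ∈ B, ¬ IsPrimitiveRoot ξ (ℓ ^ N) := by
  have hp : ℓ.Prime := Fact.out
  have : CharZero B := charZero_of_injective_algebraMap (algebraMap K B).injective
  have hfin : FiniteDimensional ℚ B := Module.Finite.trans K _
  -- With $d=[B:\mathbb{Q}]$, a primitive root of order $\ell^{d+1}$ has degree $\ell^d(\ell-1)>d$.
  refine ⟨Module.finrank ℚ B + 1, fun ξ hξ h ↦ ?_⟩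
  have h' : IsPrimitiveRoot (⟨ξ, hξ⟩ : B) (ℓ ^ (Module.finrank ℚ B + 1)) :=
    IsPrimitiveRoot.coe_submonoidClass_iff.1 h
  have h1 := minpoly.natDegree_le (A := ℚ) (⟨ξ, hξ⟩ : B)
  rw [← Polynomial.cyclotomic_eq_minpoly_rat h' (pow_pos hp.pos _),
    Polynomial.natDegree_cyclotomic, Nat.totient_prime_pow_succ hp] at h1
  have h2 := Nat.lt_pow_self (n := Module.finrank ℚ B) hp.one_lt
  have h3 := Nat.le_mul_of_pos_right (ℓ ^ Module.finrank ℚ B) (Nat.sub_pos_of_lt hp.one_lt)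
  omega

variable {Ω : Type*} [Field Ω] [Algebra K Ω] [Algebra Kinf Ω] [IsScalarTower K Kinf Ω]

/-- Otherwise the elements of $K_\infty$ fixed by $\sigma$ lie in some layer $K_n$. As $\sigma$
fixes $z$ and all $\xi\in\mu_{\ell^\infty}$, the coordinates of $\xi$ in powers of $z$ are fixed
too, so $\mu_{\ell^\infty}\subset K_n(z)$, a number field. -/
theorem restrictNormal_eq_one_of_fixes_roots_of_unity [NumberField K] [Normal K Kinf]
    [Algebra.IsAlgebraic K Ω] {z : Ω}
    (hz : z ^ ℓ = 1) (hμ : ∀ N, ∃ ξ ∈ Kinf⟮z⟯, IsPrimitiveRoot ξ (ℓ ^ N)) {σ : Gal(Ω/K)}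
    (hσ : ∀ ξ n, ξ ^ ℓ ^ n = 1 → σ ξ = ξ) : σ.restrictNormal Kinf = 1 := by
  by_contra hne
  obtain ⟨n, hn⟩ := exists_mem_layer_of_fixed ℓ hne
  have hzK : IsIntegral K z := Algebra.IsIntegral.isIntegral z
  have hzi : IsIntegral Kinf z := hzK.tower_top
  have := finiteDimensional_layer ℓ K Kinf n
  have := IntermediateField.adjoin.finiteDimensional hzK
  let ι := IsScalarTower.toAlgHom K Kinf Ω
  have : FiniteDimensional K ((layer ℓ K Kinf n).map ι) :=
    (equivMap (layer ℓ K Kinf n) ι).toLinearEquiv.finiteDimensional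
  obtain ⟨N, hN⟩ := exists_forall_not_isPrimitiveRoot ℓ ((layer ℓ K Kinf n).map ι ⊔ K⟮z⟯)
  obtain ⟨ξ, hξ, hprim⟩ := hμ N
  refine hN ξ ?_ hprim
  obtain ⟨f, hf, hfξ⟩ := (adjoin.powerBasis hzi).exists_eq_aeval ⟨ξ, hξ⟩
  rw [adjoin.powerBasis_dim] at hf
  have hfξ' : ξ = Polynomial.aeval z f := by
    have := congrArg (algebraMap Kinf⟮z⟯ Ω) hfξ
    rw [adjoin.powerBasis_gen, ← Polynomial.aeval_algebraMap_apply, AdjoinSimple.algebraMap_gen]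
      at this
    exact this
  let r : Kinf →+* Kinf := (σ.restrictNormal Kinf : Gal(Kinf/K))
  have h1 : Polynomial.aeval z (f.map r) = ξ := by
    have h2 : σ ξ = Polynomial.aeval z (f.map r) := by
      conv_lhs => rw [hfξ']
      rw [Polynomial.aeval_def, Polynomial.aeval_def, Polynomial.eval₂_map]
      have h3 := Polynomial.hom_eval₂ f (algebraMap Kinf Ω) (σ : Ω →+* Ω) z
      have h4 : ((σ : Ω →+* Ω)).comp (algebraMap Kinf Ω) = (algebraMap Kinf Ω).comp r := by
        ext x
        exact (σ.restrictNormal_commutes Kinf x).symm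
      rw [h4] at h3
      refine h3.trans ?_
      congr 1
      exact hσ z 1 (by rwa [pow_one])
    rw [← h2, hσ ξ N hprim.pow_eq_one]
  -- Both polynomials have degree below that of the minimal polynomial of $z$ and take the value
  -- $\xi$ at $z$.
  have hfix : f.map r = f := by
    by_contra hne
    have h2 : Polynomial.aeval z (f.map r - f) = 0 := by rw [map_sub, h1, ← hfξ', sub_self]
    have h3 := Polynomial.natDegree_le_natDegree
      (minpoly.degree_le_of_ne_zero Kinf z (sub_ne_zero.2 hne) h2)
    have h4 := Polynomial.natDegree_sub_le (f.map r) f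
    rw [Polynomial.natDegree_map, max_self] at h4
    omega
  rw [hfξ', Polynomial.aeval_eq_sum_range]
  refine sum_mem fun i _ ↦ ?_
  rw [Algebra.smul_def]
  refine mul_mem (le_sup_left (α := IntermediateField K Ω) ?_)
    (pow_mem (le_sup_right (α := IntermediateField K Ω) (mem_adjoin_simple_self K z)) i)
  refine ⟨f.coeff i, hn _ ?_, rfl⟩
  have := congrArg (fun g ↦ g.coeff i) hfix
  rwa [Polynomial.coeff_map] at this

/-- Let $M=K(\mu_{\ell^\infty})$, so that $K_\infty\subset M\subset K_\infty(z)$. Elements of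
$\mathrm{Gal}(M/K_\infty)$ have finite order. Conversely, an element of finite order in
$\mathrm{Gal}(M/K)$ is trivial on $K_\infty$ because $\mathbb{Z}_\ell$ is torsion free. Hence the
elements of finite order have fixed field exactly $K_\infty$. -/
theorem cyclotomicZq_eq_fieldRange [NumberField K] [IsGalois K Kinf] [IsGalois K Ω]
    [IsAlgClosed Ω] {z : Ω} (hz : IsPrimitiveRoot z ℓ)
    (hμ : ∀ N, ∃ ξ ∈ Kinf⟮z⟯, IsPrimitiveRoot ξ (ℓ ^ N)) :
    cyclotomicZq ℓ K Ω = (IsScalarTower.toAlgHom K Kinf Ω).fieldRange := by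
  have hp : ℓ.Prime := Fact.out
  set M := adjoin K {ζ : Ω | ∃ n : ℕ, ζ ^ ℓ ^ n = 1} with hM
  have hμM : ∀ (ξ : Ω) n, ξ ^ ℓ ^ n = 1 → ξ ∈ M := fun ξ n h ↦ subset_adjoin _ _ ⟨n, h⟩
  have hμz : ∀ (ζ : Ω) n, ζ ^ ℓ ^ n = 1 → ζ ∈ Kinf⟮z⟯ := fun ζ n h ↦ by
    obtain ⟨ξ, hξ, hprim⟩ := hμ n
    have : NeZero (ℓ ^ n) := ⟨pow_ne_zero _ hp.ne_zero⟩
    obtain ⟨i, -, rfl⟩ := hprim.eq_pow_of_pow_eq_one h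
    exact pow_mem hξ i
  have hgal : IsGalois K M := by
    have : CharZero Ω := charZero_of_injective_algebraMap (algebraMap K Ω).injective
    have h1 : {ζ : Ω | ∃ n : ℕ, ζ ^ ℓ ^ n = 1} =
        {ζ : Ω | ∃ m ∈ Set.range (ℓ ^ ·), m ≠ 0 ∧ ζ ^ m = 1} := by
      ext ζ
      simp [hp.ne_zero]
    rw [hM, h1]
    exact (isAbelianGalois_adjoin_roots_of_unity _).toIsGalois
  have hfix : ∀ σ : Gal(Ω/K), (∀ x ∈ M, σ x = x) → σ.restrictNormal Kinf = 1 := fun σ hσ ↦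
    restrictNormal_eq_one_of_fixes_roots_of_unity ℓ hz.pow_eq_one hμ
      fun ξ n h ↦ hσ ξ (hμM ξ n h)
  have hres : ∀ (σ : Gal(Ω/K)) (y : Kinf), σ.restrictNormal Kinf = 1 →
      σ (algebraMap Kinf Ω y) = algebraMap Kinf Ω y := fun σ y h ↦ by
    rw [← σ.restrictNormal_commutes Kinf y, h]; rfl
  have hle : ∀ y : Kinf, algebraMap Kinf Ω y ∈ M := fun y ↦ by
    rw [← InfiniteGalois.fixedField_fixingSubgroup M, IntermediateField.mem_fixedField_iff]
    exact fun σ hσ ↦ hres σ y (hfix σ ((mem_fixingSubgroup_iff _ _).1 hσ))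
  ext x
  rw [mem_cyclotomicZq]
  constructor
  · rintro ⟨hx, h⟩
    rw [← InfiniteGalois.fixedField_fixingSubgroup (AlgHom.fieldRange _),
      IntermediateField.mem_fixedField_iff]
    intro σ hσ
    have hσ' : ∀ y : Kinf, σ (algebraMap Kinf Ω y) = algebraMap Kinf Ω y := fun y ↦
      (mem_fixingSubgroup_iff _ _).1 hσ _ ⟨y, rfl⟩
    have hσz : ∃ k, 0 < k ∧ (σ ^ k) z = z := by
      have : NeZero ℓ := ⟨hp.ne_zero⟩
      obtain ⟨i, hi, h⟩ := hz.eq_pow_of_pow_eq_one (ξ := σ z)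
        (by rw [← map_pow, hz.pow_eq_one, map_one])
      have hpow : ∀ k, (σ ^ k) z = z ^ (i ^ k) := fun k ↦ by
        induction k with
        | zero => simp
        | succ k ih => rw [pow_succ', AlgEquiv.mul_apply, ih, map_pow, ← h, ← pow_mul, pow_succ']
      have hcop : i.Coprime ℓ := by
        have h2 : IsPrimitiveRoot (z ^ i) ℓ := by
          rw [h]; exact hz.map_of_injective σ.injective
        exact (hz.pow_iff_coprime hp.pos i).1 h2
      -- If $\sigma z=z^i$ with $i$ prime to $\ell$, then $i^{\varphi(\ell)}\equiv 1$ modulo $\ell$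
      -- by Euler's theorem.
      refine ⟨ℓ.totient, Nat.totient_pos.2 hp.pos, ?_⟩
      rw [hpow, ← pow_mod_orderOf, ← hz.eq_orderOf, Nat.ModEq.pow_totient hcop, hz.eq_orderOf,
        pow_mod_orderOf, pow_one]
    obtain ⟨k, hk, hkz⟩ := hσz
    have hσk : ∀ y ∈ Kinf⟮z⟯, (σ ^ k) y = y := fun y hy ↦ by
      induction hy using adjoin_induction with
      | mem y hy => rw [Set.mem_singleton_iff.1 hy, hkz]
      | algebraMap y =>
        clear hk hkz
        induction k with
        | zero => rfl
        | succ k ih => rw [pow_succ, AlgEquiv.mul_apply, hσ', ih]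
      | add _ _ _ _ h1 h2 => rw [map_add, h1, h2]
      | inv _ _ h1 => rw [map_inv₀, h1]
      | mul _ _ _ _ h1 h2 => rw [map_mul, h1, h2]
    have hfin : IsOfFinOrder (σ.restrictNormal M) := by
      refine isOfFinOrder_iff_pow_eq_one.2 ⟨k, hk, ?_⟩
      have h1 : σ.restrictNormal M ^ k = (σ ^ k).restrictNormal M :=
        (map_pow (AlgEquiv.restrictNormalHom M) σ k).symm
      rw [h1]
      have h2 : ∀ y ∈ M, (σ ^ k) • y = y :=
        (forall_mem_adjoin_smul_eq_self_iff K _).2 fun ζ ⟨n, hn⟩ ↦ hσk ζ (hμz ζ n hn)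
      ext y
      exact (AlgEquiv.restrictNormal_commutes (σ ^ k) M y).trans (h2 y y.2)
    have h1 := congrArg (algebraMap M Ω) (h _ hfin)
    rwa [AlgEquiv.restrictNormal_commutes] at h1
  · rintro ⟨y, rfl⟩
    refine ⟨hle y, fun τ hτ ↦ ?_⟩
    obtain ⟨σ, rfl⟩ := AlgEquiv.restrictNormalHom_surjective (E := Ω) τ
    obtain ⟨k, hk, hk1⟩ := isOfFinOrder_iff_pow_eq_one.1 hτ
    have h1 : (σ ^ k).restrictNormal Kinf = 1 := hfix _ fun x hx ↦ by
      rw [← map_pow] at hk1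
      have h2 := AlgEquiv.restrictNormal_commutes (σ ^ k) M ⟨x, hx⟩
      have h3 : (σ ^ k).restrictNormal M = 1 := hk1
      rw [h3] at h2
      exact h2.symm
    have h2 : σ.restrictNormal Kinf = 1 := by
      refine eq_one_of_isOfFinOrder ℓ (isOfFinOrder_iff_pow_eq_one.2 ⟨k, hk, ?_⟩)
      have h3 : AlgEquiv.restrictNormalHom Kinf (σ ^ k) = 1 := h1
      rwa [map_pow] at h3
    apply Subtype.ext
    have h3 := AlgEquiv.restrictNormal_commutes σ M ⟨algebraMap Kinf Ω y, hle y⟩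
    exact h3.trans (hres σ y h2)

variable (K Kinf)

/-- If `Kinf` is not the cyclotomic `ℤ_ℓ`-extension, then the degrees of the places of its layers
are not all divisible by a high power of `ℓ`. -/
theorem exists_lt_norm_placeDeg [NumberField K] (hℓ : ℓ ≠ 2)
    (hcyc : ¬ IsCyclotomicZlExtension ℓ K Kinf) :
    ∃ N : ℕ, ∀ n, ∃ 𝔭 : HeightOneSpectrum (𝓞 (layer ℓ K Kinf n)),
      (ℓ : ℝ) ^ (-(N : ℤ)) < ‖placeDeg ℓ 𝔭‖ := by
  by_contra! hN
  have hp : ℓ.Prime := Fact.out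
  have : NeZero ℓ := ⟨hp.ne_zero⟩
  refine hcyc ?_
  have := IsZlExtension.isGalois ℓ (K := K) (Kinf := Kinf)
  let Ω := AlgebraicClosure K
  let φ : Kinf →ₐ[K] Ω := IsAlgClosed.lift
  let _ : Algebra Kinf Ω := φ.toRingHom.toAlgebra
  have : IsScalarTower K Kinf Ω := .of_algebraMap_eq fun x ↦ (φ.commutes x).symm
  have : CharZero Ω := charZero_of_injective_algebraMap (algebraMap K Ω).injective
  obtain ⟨z, hz⟩ := HasEnoughRootsOfUnity.exists_primitiveRoot Ω ℓ
  have h := cyclotomicZq_eq_fieldRange (K := K) (Kinf := Kinf) ℓ hz fun N ↦ ?_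
  · exact ⟨(AlgEquiv.ofInjectiveField _).trans (IntermediateField.equivOfEq h).symm⟩
  obtain ⟨n, hn⟩ := hN N
  exact exists_mem_adjoin_isPrimitiveRoot (F := layer ℓ K Kinf n) hℓ (fun 𝔭 _ ↦ hn 𝔭) hz

end ZlExtension

end LogClass

namespace LogClass

/-! ### The degree of classes and its passage to the limit -/

section Degree

variable {ℓ : ℕ} [Fact ℓ.Prime] (F : Type*) [Field F] [NumberField F]

theorem norm_primeDeg_le_one (hℓ : ℓ ≠ 2) {p : ℕ} (hp : p ≠ 0) : ‖primeDeg ℓ p‖ ≤ 1 := by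
  unfold primeDeg
  split_ifs
  · exact norm_iwasawaLog_le_one hℓ (by rw [add_comm]; exact Nat.cast_add_one_ne_zero ℓ)
  · exact norm_iwasawaLog_le_one hℓ (by exact_mod_cast hp)

variable {F} in
theorem norm_placeDeg_le_one (hℓ : ℓ ≠ 2) (𝔭 : HeightOneSpectrum (𝓞 F)) :
    ‖placeDeg ℓ 𝔭‖ ≤ 1 := by
  rw [placeDeg, norm_mul]
  refine mul_le_one₀ (Padic.norm_int_le_one (logInertiaDeg ℓ 𝔭 : ℤ)) (norm_nonneg _)
    (norm_primeDeg_le_one hℓ ?_)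
  have := 𝔭.isPrime
  rw [Ne, Ideal.absNorm_eq_zero_iff]
  exact Ideal.under_ne_bot ℤ 𝔭.ne_bot

/-- The degree of logarithmic classes. -/
noncomputable def classDegree (hℓ : ℓ ≠ 2) : LogClassStar ℓ F →ₗ[ℤ_[ℓ]] ℚ_[ℓ] :=
  (principalLogDiv ℓ F).liftQ (logDegree ℓ F) fun _ hD ↦ logDegree_eq_zero_of_mem hℓ hD

@[simp]
theorem classDegree_mkQ (hℓ : ℓ ≠ 2) (D : LogDiv ℓ F) :
    classDegree F hℓ ((principalLogDiv ℓ F).mkQ D) = logDegree ℓ F D := rfl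

theorem ker_classDegree (hℓ : ℓ ≠ 2) : LinearMap.ker (classDegree F hℓ) = logClassGroup ℓ F :=
  Submodule.ker_liftQ _ _ _

theorem norm_classDegree_le_one (hℓ : ℓ ≠ 2) (c : LogClassStar ℓ F) :
    ‖classDegree F hℓ c‖ ≤ 1 := by
  obtain ⟨D, rfl⟩ := (principalLogDiv ℓ F).mkQ_surjective c
  rw [classDegree_mkQ, logDegree, Finsupp.linearCombination_apply]
  refine (IsUltrametricDist.norm_sum_le_of_forall_le_of_nonneg zero_le_one fun 𝔭 _ ↦ ?_)
  rw [show (fun i a ↦ a • placeDeg ℓ i) 𝔭 (D 𝔭) = (D 𝔭 : ℚ_[ℓ]) * placeDeg ℓ 𝔭 from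
    Algebra.smul_def _ _, norm_mul]
  exact mul_le_one₀ (D 𝔭).norm_le_one (norm_nonneg _) (norm_placeDeg_le_one hℓ 𝔭)

variable {F} in
theorem classDegree_of_mem_logNormGraph {E : Type*} [Field E] [NumberField E] [Algebra F E]
    (hℓ : ℓ ≠ 2) {c : LogClassStar ℓ E × LogClassStar ℓ F} (hc : c ∈ logNormGraph ℓ F E) :
    classDegree F hℓ c.2 = classDegree E hℓ c.1 := by
  obtain ⟨D, rfl⟩ := hc
  exact logDegree_logNorm D

theorem exists_mem_logNormGraph {E : Type*} [Field E] [NumberField E] [Algebra F E]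
    (c : LogClassStar ℓ E) : ∃ d : LogClassStar ℓ F, (c, d) ∈ logNormGraph ℓ F E := by
  obtain ⟨D, rfl⟩ := (principalLogDiv ℓ E).mkQ_surjective c
  exact ⟨_, D, rfl⟩

/-- A nonempty fibre of the degree is a translate of the finite logarithmic class group. -/
theorem finite_classDegree_eq (hℓ : ℓ ≠ 2) (h : GrossKuzmin ℓ F) (a : ℚ_[ℓ]) :
    Finite {c : LogClassStar ℓ F // classDegree F hℓ c = a} := by
  rcases isEmpty_or_nonempty {c : LogClassStar ℓ F // classDegree F hℓ c = a} with _ | ⟨⟨c, hc⟩⟩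
  · infer_instance
  have : Finite (logClassGroup ℓ F) := h
  refine Finite.of_injective (β := logClassGroup ℓ F)
    (fun d ↦ ⟨d.1 - c, by rw [← ker_classDegree F hℓ, LinearMap.mem_ker, map_sub, d.2, hc,
      sub_self]⟩) fun d d' h ↦ ?_
  exact Subtype.ext (sub_left_injective (congrArg Subtype.val h))

variable {F} in
theorem exists_classDegree_eq (hℓ : ℓ ≠ 2) {N : ℕ} {𝔭 : HeightOneSpectrum (𝓞 F)}
    (h : (ℓ : ℝ) ^ (-(N : ℤ)) < ‖placeDeg ℓ 𝔭‖) :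
    ∃ c : LogClassStar ℓ F, classDegree F hℓ c = (ℓ : ℚ_[ℓ]) ^ N := by
  have h0 : placeDeg ℓ 𝔭 ≠ 0 :=
    norm_pos_iff.1 ((zpow_pos (Nat.cast_pos.2 (Fact.out : ℓ.Prime).pos) _).trans h)
  -- The quotient is an $\ell$-adic integer, and it serves as the coefficient of $\mathfrak p$ in a
  -- divisor of degree $\ell^N$.
  have h1 : ‖(ℓ : ℚ_[ℓ]) ^ N / placeDeg ℓ 𝔭‖ ≤ 1 := by
    rw [norm_div, Padic.norm_p_pow]
    exact (div_le_one (norm_pos_iff.2 h0)).2 h.le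
  let a : ℤ_[ℓ] := ⟨_, h1⟩
  refine ⟨(principalLogDiv ℓ F).mkQ (Finsupp.single 𝔭 a), ?_⟩
  rw [classDegree_mkQ, logDegree, Finsupp.linearCombination_single, Algebra.smul_def,
    show algebraMap ℤ_[ℓ] ℚ_[ℓ] a = (ℓ : ℚ_[ℓ]) ^ N / placeDeg ℓ 𝔭 from rfl,
    div_mul_cancel₀ _ h0]

end Degree

section Limit

variable {ℓ : ℕ} [Fact ℓ.Prime] (K Kinf : Type*) [Field K] [NumberField K] [Field Kinf]
  [Algebra K Kinf] [IsZlExtension ℓ K Kinf]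

/-- The degree of a norm coherent sequence of logarithmic classes. -/
noncomputable def limDegree (hℓ : ℓ ≠ 2) : limLogClassStar ℓ K Kinf →ₗ[ℤ_[ℓ]] ℤ_[ℓ] where
  toFun c := ⟨classDegree _ hℓ (c.1 0), norm_classDegree_le_one _ hℓ _⟩
  map_add' c d := Subtype.ext (map_add (classDegree (layer ℓ K Kinf 0) hℓ) (c.1 0) (d.1 0))
  map_smul' a c := Subtype.ext <|
    (map_smul (classDegree (layer ℓ K Kinf 0) hℓ) a (c.1 0)).trans (Algebra.smul_def _ _)

theorem classDegree_eq_limDegree (hℓ : ℓ ≠ 2) (c : limLogClassStar ℓ K Kinf) (n : ℕ) :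
    classDegree (layer ℓ K Kinf n) hℓ (c.1 n) = limDegree K Kinf hℓ c := by
  induction n with
  | zero => rfl
  | succ n ih =>
    let _ := layerAlgebra ℓ K Kinf n
    exact (classDegree_of_mem_logNormGraph hℓ (c.2 n)).symm.trans ih

/-- The norm coherent sequences of degree `0` are the norm coherent sequences of logarithmic
classes of degree `0`. -/
noncomputable def kerLimDegreeEquiv (hℓ : ℓ ≠ 2) :
    LinearMap.ker (limDegree K Kinf hℓ) ≃ₗ[ℤ_[ℓ]] limLogClassGroup ℓ K Kinf where
  toFun c := ⟨fun n ↦ ⟨c.1.1 n, by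
    rw [← ker_classDegree _ hℓ, LinearMap.mem_ker, classDegree_eq_limDegree K Kinf hℓ c.1 n,
      LinearMap.mem_ker.1 c.2]
    rfl⟩, c.1.2⟩
  map_add' _ _ := rfl
  map_smul' _ _ := rfl
  invFun c := ⟨⟨fun n ↦ c.1 n, c.2⟩, Subtype.ext <| LinearMap.mem_ker.1 <| by
    rw [ker_classDegree]; exact (c.1 0).2⟩
  left_inv _ := rfl
  right_inv _ := rfl

-- The classes of degree $a$ form an inverse system of finite nonempty sets, since norms preserve
-- degrees; such a system has a nonempty limit.
open CategoryTheory in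
theorem exists_limDegree_eq (hℓ : ℓ ≠ 2) (hGK : ∀ n, GrossKuzmin ℓ (layer ℓ K Kinf n))
    {a : ℤ_[ℓ]} (h : ∀ n, ∃ c, classDegree (layer ℓ K Kinf n) hℓ c = a) :
    ∃ c, limDegree K Kinf hℓ c = a := by
  let S (n : ℕ) : Type _ := {c : LogClassStar ℓ (layer ℓ K Kinf n) // classDegree _ hℓ c = a}
  have hS (n : ℕ) : Finite (S n) := finite_classDegree_eq _ hℓ (hGK n) a
  have hne (n : ℕ) : Nonempty (S n) := let ⟨c, hc⟩ := h n; ⟨⟨c, hc⟩⟩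
  have hf (n : ℕ) (c : S (n + 1)) : ∃ d : S n, letI := layerAlgebra ℓ K Kinf n;
      (c.1, d.1) ∈ logNormGraph ℓ (layer ℓ K Kinf n) (layer ℓ K Kinf (n + 1)) := by
    let _ := layerAlgebra ℓ K Kinf n
    obtain ⟨d, hd⟩ := exists_mem_logNormGraph (layer ℓ K Kinf n) c.1
    exact ⟨⟨d, (classDegree_of_mem_logNormGraph hℓ hd).trans c.2⟩, hd⟩
  choose f hf using hf
  let G : ℕᵒᵖ ⥤ Type _ := Functor.ofOpSequence (X := S) fun n ↦ ↾(f n)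
  have : ∀ j, Finite (G.obj j) := fun j ↦ hS j.unop
  have : ∀ j, Nonempty (G.obj j) := fun j ↦ hne j.unop
  obtain ⟨s, hs⟩ := nonempty_sections_of_finite_cofiltered_system G
  have hs' (n : ℕ) : f n (s (.op (n + 1))) = s (.op n) := by
    have := hs (homOfLE n.le_succ).op
    rw [Functor.ofOpSequence_map_homOfLE_succ] at this
    exact this
  refine ⟨⟨fun n ↦ (s (.op n) : S n).1, fun n ↦ ?_⟩, Subtype.ext (s (.op 0) : S 0).2⟩
  have := hf n (s (.op (n + 1)))
  rwa [hs'] at this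

end Limit

/-- A linear map to a principal ideal domain, seen as a module, is split onto its image. -/
theorem nonempty_equiv_ker_prod {R M : Type*} [CommRing R] [IsDomain R] [IsPrincipalIdealRing R]
    [AddCommMonoid M] [Module R M] (f : M →ₗ[R] R) (hf : f ≠ 0) :
    Nonempty (M ≃ₗ[R] LinearMap.ker f × R) := by
  -- A module over a ring has negatives, given by the scalar $-1$.
  let _ : AddCommGroup M := Module.addCommMonoidToAddCommGroup R
  obtain ⟨a, ha⟩ := IsPrincipalIdealRing.principal (LinearMap.range f)
  have ha0 : a ≠ 0 := by
    rintro rfl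
    rw [Submodule.span_singleton_eq_bot.2 rfl, LinearMap.range_eq_bot] at ha
    exact hf ha
  have ham : a ∈ LinearMap.range f := ha ▸ Submodule.mem_span_singleton_self a
  obtain ⟨m, hm⟩ := ham
  have hdvd (x : M) : ∃ r, r * a = f x := by
    have := ha ▸ LinearMap.mem_range_self f x
    exact Submodule.mem_span_singleton.1 this
  choose g hg using hdvd
  have hg' {x : M} {r : R} (h : r * a = f x) : g x = r :=
    mul_right_cancel₀ ha0 ((hg x).trans h.symm)
  refine ⟨LinearEquiv.ofBijective (M₂ := LinearMap.ker f × R)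
    -- Here $a=f(m)$ generates the image and $g=f/a$; the vector $m$ spans a complement of the
    -- kernel.
    { toFun x := (⟨x - g x • m, by simp [hm, hg]⟩, g x)
      map_add' x y := ?_
      map_smul' c x := ?_ } ⟨fun x y h ↦ ?_, fun ⟨y, r⟩ ↦ ⟨y + r • m, ?_⟩⟩⟩
  · have : g (x + y) = g x + g y := hg' (by rw [add_mul, hg, hg, map_add])
    ext <;> simp [this, add_smul]; abel
  · have : g (c • x) = c * g x := hg' (by rw [mul_assoc, hg, map_smul, smul_eq_mul])
    ext <;> simp [this, smul_sub, mul_smul]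
  · have h1 : g x = g y := congrArg Prod.snd h
    have h2 : x - g x • m = y - g y • m := congrArg (fun z ↦ (z.1 : M)) h
    rwa [h1, sub_left_inj] at h2
  · have h1 : g (y + r • m) = r := hg' (by
      rw [map_add, map_smul, hm, LinearMap.mem_ker.1 y.2, zero_add, smul_eq_mul])
    ext <;> simp [h1]

end LogClass

theorem mainTheorem7 (ℓ : ℕ) [Fact ℓ.Prime] (hℓ : ℓ ≠ 2)
    (K : Type*) [Field K] [NumberField K]
    (Kinf : Type*) [Field Kinf] [Algebra K Kinf] [LogClass.IsZlExtension ℓ K Kinf]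
    (hcyc : ¬ LogClass.IsCyclotomicZlExtension ℓ K Kinf)
    (hGK : ∀ n : ℕ, LogClass.GrossKuzmin ℓ (LogClass.layer ℓ K Kinf n)) :
    Nonempty (LogClass.limLogClassStar ℓ K Kinf ≃ₗ[ℤ_[ℓ]]
      LogClass.limLogClassGroup ℓ K Kinf × ℤ_[ℓ]) := by
  obtain ⟨N, hN⟩ := LogClass.exists_lt_norm_placeDeg ℓ K Kinf hℓ hcyc
  -- That $N$ does not depend on the layer is essential: one and the same degree must occur at all
  -- layers.
  obtain ⟨c, hc⟩ := LogClass.exists_limDegree_eq K Kinf hℓ hGK (a := (ℓ : ℤ_[ℓ]) ^ N) fun n ↦ by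
    obtain ⟨𝔭, h𝔭⟩ := hN n
    obtain ⟨c, hc⟩ := LogClass.exists_classDegree_eq hℓ h𝔭
    exact ⟨c, by rw [hc]; push_cast; rfl⟩
  have h0 : LogClass.limDegree K Kinf hℓ ≠ 0 := fun h ↦ by
    rw [h, LinearMap.zero_apply] at hc
    exact pow_ne_zero N (Nat.cast_ne_zero.2 (Fact.out : ℓ.Prime).ne_zero) hc.symm
  obtain ⟨e⟩ := LogClass.nonempty_equiv_ker_prod (LogClass.limDegree K Kinf hℓ) h0
  exact ⟨e.trans ((LogClass.kerLimDegreeEquiv K Kinf hℓ).prodCongr (.refl _ _))⟩
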